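/- Let $m,n\ge 1$, let $\Sigma\subset\mathbb R^{n-1}$ be a compact, smoothly embedded $(m-1)$-dimensional manifold (without boundary), let $a,v\in\mathbb R$, and let \[ F:\Sigma\times\mathbb R\to\mathbb R^n,\qquad F(x,t)=(x,0)+(a+t)\,v\,\mathbf e_n,\qquad \tilde F(x,t)=\frac{F(x,t)}{|t|^{1/2}}\quad(t<0),\qquad S=\tilde F\bigl(\Sigma\times(-\infty,0)\bigr). \] Let $\mathcal H^d$ be $d$-dimensional Hausdorff measure normalized to agree with Lebesgue measure on $\mathbb R^d$. Put $\Phi_d(y)=(4\pi)^{-d/2}e^{-|y|^2/4}$ and $\Phi_d[A]=\int_A\Phi_d\,d\mathcal H^d$, and let \[ \Phi_m[\tilde F]=\int_{\mathbb R^n}\#\{(x,t)\in\Sigma\times(-\infty,0):\tilde F(x,t)=y\}\;\Phi_m(y)\,d\mathcal H^m(y) \] be the Gaussian area of $S$ counted with multiplicity. Let \[ \operatorname{entropy}(\Sigma)=\sup_{\lambda>0,\;w\in\mathbb R^{n-1}}\Phi_{m-1}[\lambda\Sigma+w]. \] For $A\subset\mathbb R^{n-1}$, let $C(A)=\{rx:x\in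 A,\ r>0\}$ be the cone over $A$, with density \[ \Theta(C(A))=\frac{1}{\omega_mR^m}\int_{\overline{\mathbb B}(0,R)}\#\{(x,r)\in A\times(0,\infty):rx=y\}\,d\mathcal H^m(y) \] (area counted with multiplicity; the value does not depend on $R>0$), where $\omega_m$ is the volume of the unit ball of $\mathbb R^m$, and let $\operatorname{mcd}(\Sigma)=\sup_{w\in\mathbb R^{n-1}}\Theta(C(\Sigma+w))$. All these quantities take values in $[0,\infty]$. Then \[ \Phi_m[S]\;\le\;\Phi_m[\tilde F]\;\le\;\operatorname{entropy}(\Sigma)+\Theta(C(\Sigma))\;\le\;\operatorname{entropy}(\Sigma)+\operatorname{mcd}(\Sigma). \] -/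

import Mathlib

open MeasureTheory Set
open scoped ENNReal ContDiff Pointwise

noncomputable section

/-- A subset `S` of a finite-dimensional real normed space `E` is a smooth embedded submanifold
(without boundary) of dimension `d`: near each of its points there is a smooth diffeomorphism `e`
between open subsets of `E` that straightens `S` to an open piece of a `d`-dimensional linear
subspace. -/
def IsEmbeddedSubmanifold {E : Type*} [NormedAddCommGroup E] [NormedSpace ℝ E]
    (d : ℕ) (S : Set E) : Prop :=
  ∀ x ∈ S, ∃ (e : OpenPartialHomeomorph E E) (W : Submodule ℝ E),
    x ∈ e.source ∧ ContDiffOn ℝ ∞ e e.source ∧ ContDiffOn ℝ ∞ e.symm e.target ∧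
      Module.finrank ℝ W = d ∧ e '' (e.source ∩ S) = e.target ∩ (W : Set E)

/-- The Gaussian weight `Φ_m(x) = (4π)^{-m/2} exp(-|x|²/4)`. -/
def gaussianWeight {E : Type*} [NormedAddCommGroup E] (m : ℕ) (x : E) : ℝ :=
  (4 * Real.pi) ^ (-(m : ℝ) / 2) * Real.exp (-‖x‖ ^ 2 / 4)

section Areas

variable {E : Type*} [NormedAddCommGroup E] [InnerProductSpace ℝ E] [MeasurableSpace E]
  [BorelSpace E]

/-- The Gaussian area `Φ_m[S] = ∫_S Φ_m dℋ^m`, where `ℋ^m` is the Hausdorff measure normalized to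
agree with Lebesgue measure on `ℝ^m`. -/
def gaussianArea (m : ℕ) (S : Set E) : ℝ≥0∞ :=
  ∫⁻ y in S, ENNReal.ofReal (gaussianWeight m y) ∂μHE[m]

/-- The number of points of `A` that `f` maps to `y`. -/
def preimageCount {X : Type*} (f : X → E) (A : Set X) (y : E) : ℝ≥0∞ :=
  ({p | p ∈ A ∧ f p = y}.encard : ℝ≥0∞)

/-- The Gaussian area `Φ_m[f|A]` of the image of `A` under `f`, counted with multiplicity. -/
def gaussianAreaMult {X : Type*} (m : ℕ) (f : X → E) (A : Set X) : ℝ≥0∞ :=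
  ∫⁻ y, preimageCount f A y * ENNReal.ofReal (gaussianWeight m y) ∂μHE[m]

/-- The entropy of a `d`-dimensional `S ⊆ E`: the supremum of the Gaussian areas of all images
`lam • S + w` of `S` under dilations and translations. -/
def entropy (d : ℕ) (S : Set E) : ℝ≥0∞ :=
  ⨆ (lam : ℝ) (_ : 0 < lam) (w : E), gaussianArea d ((fun x => lam • x + w) '' S)

/-- The parametrization `(x, r) ↦ r x` of the cone `C(S) = {r x : x ∈ S, r > 0}`
by `S × (0, ∞)`. -/
def coneMap (p : E × ℝ) : E := p.2 • p.1

/-- The `m`-dimensional area, counted with multiplicity, of the part of the cone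
`C(S) = {r x : x ∈ S, r > 0}` in the closed ball of radius `R` about the origin. -/
def coneArea (m : ℕ) (S : Set E) (R : ℝ) : ℝ≥0∞ :=
  ∫⁻ y in Metric.closedBall (0 : E) R, preimageCount coneMap (S ×ˢ Ioi (0 : ℝ)) y ∂μHE[m]

/-- `ω_m`, the volume of the unit ball in `ℝ^m`. -/
def unitBallVolume (m : ℕ) : ℝ≥0∞ := volume (Metric.ball (0 : EuclideanSpace ℝ (Fin m)) 1)

/-- The density `Θ(C(S)) = area(C(S) ∩ B(0,R)) / (ω_m R^m)` of the `m`-dimensional cone over `S`,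
computed with `R = 1`; `coneDensity_eq` shows that any other radius gives the same value. -/
def coneDensity (m : ℕ) (S : Set E) : ℝ≥0∞ := coneArea m S 1 / unitBallVolume m

/-- The maximal cone density `mcd(S) = sup_w Θ(C(S + w))`, for `S` such that the cones
`C(S + w)` are `m`-dimensional. -/
def maximalConeDensity (m : ℕ) (S : Set E) : ℝ≥0∞ :=
  ⨆ w : E, coneDensity m ((fun x => x + w) '' S)

lemma preimageCount_coneMap_smul (S : Set E) {R : ℝ} (hR : 0 < R) (y : E) :
    preimageCount coneMap (S ×ˢ Ioi (0 : ℝ)) (R • y) =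
      preimageCount coneMap (S ×ˢ Ioi (0 : ℝ)) y := by
  unfold preimageCount
  congr 1
  have hinj : Function.Injective (fun p : E × ℝ => (p.1, R * p.2)) := by
    rintro ⟨x, s⟩ ⟨x', s'⟩ h
    simpa [hR.ne'] using h
  rw [← hinj.encard_image {p | p ∈ S ×ˢ Ioi (0 : ℝ) ∧ coneMap p = y}]
  congr 1
  ext ⟨x, s⟩
  simp only [coneMap, mem_ofPred_eq, mem_image, mem_prod, mem_Ioi, Prod.mk.injEq, Prod.exists]
  constructor
  · rintro ⟨⟨hx, hs⟩, h⟩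
    refine ⟨x, R⁻¹ * s, ⟨⟨hx, by positivity⟩, ?_⟩, rfl, by field_simp⟩
    rw [mul_smul, h, inv_smul_smul₀ hR.ne']
  · rintro ⟨x', s', ⟨⟨hx, hs⟩, h⟩, rfl, rfl⟩
    exact ⟨⟨hx, by positivity⟩, by rw [mul_smul, h]⟩

lemma coneArea_eq (m : ℕ) (S : Set E) {R : ℝ} (hR : 0 < R) :
    coneArea m S R = ENNReal.ofReal R ^ m * coneArea m S 1 := by
  have hemb : MeasurableEmbedding (fun x : E => R • x) :=
    (Homeomorph.smulOfNeZero R hR.ne').measurableEmbedding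
  have hmap : (μHE[m] : Measure E) =
      ENNReal.ofReal R ^ m • Measure.map (fun x : E => R • x) μHE[m] := by
    ext s hs
    rw [Measure.smul_apply, hemb.map_apply]
    have h := Measure.euclideanHausdorffMeasure_smul₀ m hR.ne' ((fun x : E => R • x) ⁻¹' s)
    have hs' : R • ((fun x : E => R • x) ⁻¹' s) = s :=
      image_preimage_eq s (Homeomorph.smulOfNeZero (α := E) R hR.ne').surjective
    rw [hs'] at h
    rw [h, ENNReal.smul_def, ENNReal.coe_pow, smul_eq_mul, smul_eq_mul]
    congr 2
    rw [ENNReal.ofReal, Real.toNNReal_of_nonneg hR.le]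
    congr 1
    ext
    simp [abs_of_pos hR]
  have hball : (fun x : E => R • x) ⁻¹' Metric.closedBall 0 R = Metric.closedBall 0 1 := by
    ext x
    simp [norm_smul, abs_of_pos hR, hR]
  unfold coneArea
  conv_lhs => rw [hmap]
  rw [Measure.restrict_smul, lintegral_smul_measure, hemb.restrict_map, hemb.lintegral_map, hball]
  simp only [preimageCount_coneMap_smul S hR, smul_eq_mul]

/-- The density ratio of a cone does not depend on the radius. -/
lemma coneDensity_eq (m : ℕ) (S : Set E) {R : ℝ} (hR : 0 < R) :
    coneDensity m S =
      coneArea m S R / (unitBallVolume m * ENNReal.ofReal R ^ m) := by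
  have h0 : ENNReal.ofReal R ^ m ≠ 0 := pow_ne_zero _ (by simpa using hR)
  have h1 : ENNReal.ofReal R ^ m ≠ ⊤ := ENNReal.pow_ne_top ENNReal.ofReal_ne_top
  rw [coneDensity, coneArea_eq m S hR, mul_comm (unitBallVolume m),
    ENNReal.mul_div_mul_left _ _ h0 h1]

end Areas

/-- The point `(x, s) ∈ ℝ^{N+1}`, for `x ∈ ℝ^N` and `s ∈ ℝ`. -/
def pairPoint {N : ℕ} (x : EuclideanSpace ℝ (Fin N)) (s : ℝ) : EuclideanSpace ℝ (Fin (N + 1)) :=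
  WithLp.toLp 2 (Fin.snoc (α := fun _ => ℝ) (fun i => x i) s)

/-- The translating family `F(x,t) = (x,0) + (a+t) v e_n` in `ℝ^n`, `n = N + 1`. -/
def translatingMap {N : ℕ} (a v : ℝ) (p : EuclideanSpace ℝ (Fin N) × ℝ) :
    EuclideanSpace ℝ (Fin (N + 1)) :=
  pairPoint p.1 0 + ((a + p.2) * v) • EuclideanSpace.single (Fin.last N) (1 : ℝ)

/-- The rescaled family `F̃(x,t) = F(x,t) / |t|^{1/2}`. -/
def rescaledMap {N : ℕ} (a v : ℝ) (p : EuclideanSpace ℝ (Fin N) × ℝ) :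
    EuclideanSpace ℝ (Fin (N + 1)) :=
  (Real.sqrt |p.2|)⁻¹ • translatingMap a v p

end

/-!
In terms of `r = |t|^{-1/2}` the rescaled family is `(x, r) ↦ (r x, h r)` with height
`h r = v (a r - 1 / r)`, so it is the cone map `(x, r) ↦ r x` lifted to `ℝ^{n-1} × ℝ`. Writing `J_G`
and `J_C` for the Jacobians of the lift and of the cone map, and `J_ψ` for that of a chart `ψ` of
`Σ`, the Gram determinant of the lift differs from that of the cone map by a rank-one term in the
`r` direction, and hence (`areaJacobian_patchLift_sq`)
`J_G² = J_C² + (h' r^{m-1} J_ψ)²`, so that `J_G ≤ J_C + |h'| r^{m-1} J_ψ`.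
Integrating this against the Gaussian weight `Φ_m(r x, h) = Φ_{m-1}(r x) Φ_1(h) ≤ Φ_m(r x)` splits
the Gaussian area of the rescaled family into two parts (`lintegral_coneLift_patch_le`).

* The first part is at most the Gaussian area of the cone, counted with multiplicity. The area
  measure of the cone gives every ball about the origin the mass of `Θ(C(Σ))` times the Lebesgue
  measure of `ℝ^m`, so its Gaussian area is `Θ(C(Σ))` (`lintegral_preimageCount_coneMap_le`).
* The second part is `∫ |h'(r)| Φ_1(h(r)) Φ_{m-1}[r Σ] dr`, where `Φ_{m-1}[r Σ]` is at most the
  entropy. The remaining integral is at most one: `h` is monotone, or else it has a constant sign and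
  exactly one turning point, and then one of its two branches can be reflected so that the branches
  cover disjoint parts of the line (`lintegral_height_le_one`).

Area is compared with integrals over charts by the area formula for `C¹` immersions, with
multiplicity (`lintegral_preimageCount_eq_lintegral_areaJacobian_mul`). It follows from the fact that
near each point an immersion distorts distances by almost the same factors as its derivative, for
which the formula is known. The lift is an immersion wherever `h' ≠ 0`. If `v = 0`, it is an
isometric copy of the cone; if `v ≠ 0`, then `h'` vanishes for at most one `r`, and the corresponding
slice, a similar copy of `Σ`, has no `m`-dimensional area.
-/

open Filter Topology NNReal Module

/-! ### The area formula for immersions -/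

/-- The hypothesis makes `p ∘ q⁻¹` a well-defined `C`-Lipschitz map of `q '' s` onto
`p '' s`. -/
lemma euclideanHausdorffMeasure_image_le_of_dist_le {X Y Z : Type*} [MetricSpace Y]
    [MeasurableSpace Y] [BorelSpace Y] [MetricSpace Z] [MeasurableSpace Z] [BorelSpace Z]
    {p : X → Y} {q : X → Z} {s : Set X} {C : ℝ≥0} (d : ℕ)
    (h : ∀ x ∈ s, ∀ y ∈ s, dist (p x) (p y) ≤ C * dist (q x) (q y)) :
    μHE[d] (p '' s) ≤ (C : ℝ≥0∞) ^ d * μHE[d] (q '' s) := by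
  rcases s.eq_empty_or_nonempty with rfl | ⟨x₀, hx₀⟩
  · simp
  have : Nonempty X := ⟨x₀⟩
  set f : Z → Y := fun z => p (Function.invFunOn q s z) with hf
  have hinv : ∀ x ∈ s, Function.invFunOn q s (q x) ∈ s ∧ q (Function.invFunOn q s (q x)) = q x :=
    fun x hx => ⟨Function.invFunOn_mem ⟨x, hx, rfl⟩, Function.invFunOn_eq ⟨x, hx, rfl⟩⟩
  have hfx : ∀ x ∈ s, f (q x) = p x := by
    intro x hx
    have := h _ (hinv x hx).1 x hx
    rw [(hinv x hx).2, dist_self, mul_zero] at this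
    exact dist_le_zero.1 this
  have hlip : LipschitzOnWith C f (q '' s) := by
    refine LipschitzOnWith.of_dist_le_mul ?_
    rintro _ ⟨x, hx, rfl⟩ _ ⟨y, hy, rfl⟩
    rw [hfx x hx, hfx y hy]
    exact h x hx y hy
  have himg : p '' s = f '' (q '' s) := by
    rw [image_image]
    exact image_congr fun x hx => (hfx x hx).symm
  have := hlip.hausdorffMeasure_image_le (d := (d : ℝ)) (by positivity)
  rw [himg, Measure.euclideanHausdorffMeasure_def, Measure.euclideanHausdorffMeasure_def,
    Measure.smul_apply, Measure.smul_apply, ENNReal.smul_def, ENNReal.smul_def, smul_eq_mul,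
    smul_eq_mul, mul_left_comm]
  gcongr
  simpa using this

lemma exists_countable_measurable_partition {X : Type*} [TopologicalSpace X]
    [SecondCountableTopology X] [MeasurableSpace X] [OpensMeasurableSpace X] {B : Set X}
    (hB : MeasurableSet B) {V : X → Set X} (hV : ∀ x ∈ B, V x ∈ 𝓝 x) :
    ∃ A : ℕ → Set X, (∀ n, MeasurableSet (A n)) ∧ Pairwise (Function.onFun Disjoint A) ∧
      B = ⋃ n, A n ∧ ∀ n, A n = ∅ ∨ ∃ x ∈ B, A n ⊆ V x := by
  obtain ⟨t, htB, htc, hBt⟩ := TopologicalSpace.countable_cover_nhdsWithin (s := B)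
    (f := fun x => interior (V x))
    (fun x hx => mem_nhdsWithin_of_mem_nhds (interior_mem_nhds.2 (hV x hx)))
  rcases t.eq_empty_or_nonempty with rfl | hne
  · have : B = ∅ := by simpa using hBt
    exact ⟨fun _ => ∅, by simp, fun _ _ _ => by simp [Function.onFun], by simp [this], by simp⟩
  obtain ⟨f, rfl⟩ := htc.exists_eq_range hne
  refine ⟨fun n => B ∩ disjointed (fun n => interior (V (f n))) n, fun n => ?_, ?_, ?_, fun n => ?_⟩
  · exact hB.inter (MeasurableSet.disjointed (fun n => isOpen_interior.measurableSet) n)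
  · intro i j hij
    exact (disjoint_disjointed _ hij).mono inter_subset_right inter_subset_right
  · rw [← inter_iUnion, iUnion_disjointed]
    refine (inter_eq_left.2 fun x hx => ?_).symm
    simpa using hBt hx
  · exact Or.inr ⟨f n, htB ⟨n, rfl⟩,
      inter_subset_right.trans ((disjointed_subset _ n).trans interior_subset)⟩

section AreaFormula

variable {U F : Type*} [NormedAddCommGroup U] [InnerProductSpace ℝ U] [FiniteDimensional ℝ U]
  [NormedAddCommGroup F] [InnerProductSpace ℝ F]

lemma normDet_eq_sqrt_det_gram {ι : Type*} [Fintype ι] [DecidableEq ι]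
    (L : U →ₗ[ℝ] F) (b : OrthonormalBasis ι ℝ U) :
    L.normDet = √(Matrix.gram ℝ (fun i => L (b i))).det := by
  have h := L.normDet_sq_eq_det_gram b
  rw [← h]
  exact (Real.sqrt_sq L.normDet_nonneg).symm

lemma continuous_normDet :
    Continuous fun L : U →L[ℝ] F => (L : U →ₗ[ℝ] F).normDet := by
  simp_rw [fun L : U →L[ℝ] F => normDet_eq_sqrt_det_gram (L : U →ₗ[ℝ] F) (stdOrthonormalBasis ℝ U)]
  refine Real.continuous_sqrt.comp (Continuous.matrix_det ?_)
  refine continuous_matrix fun i j => ?_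
  simp only [Matrix.gram_apply, ContinuousLinearMap.coe_coe]
  fun_prop

lemma injective_of_normDet_ne_zero {L : U →ₗ[ℝ] F} (h : L.normDet ≠ 0) : Function.Injective L :=
  (L.normDet_ne_zero_tfae.out 0 4).1 h

lemma normDet_pos_of_injective {L : U →ₗ[ℝ] F} (h : Function.Injective L) : 0 < L.normDet :=
  L.normDet_nonneg.lt_of_ne' ((L.normDet_ne_zero_tfae.out 4 0).1 h)

/-- The Jacobian `√det(Dgᵀ Dg)` of `g` at `x`: the factor by which the derivative of `g` scales
`dim U`-dimensional volume. -/
noncomputable def areaJacobian (g : U → F) (x : U) : ℝ := (fderiv ℝ g x : U →ₗ[ℝ] F).normDet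

lemma areaJacobian_nonneg (g : U → F) (x : U) : 0 ≤ areaJacobian g x :=
  LinearMap.normDet_nonneg _

lemma continuousOn_areaJacobian {g : U → F} {O : Set U} (hO : IsOpen O) (hg : ContDiffOn ℝ 1 g O) :
    ContinuousOn (areaJacobian g) O :=
  continuous_normDet.comp_continuousOn (hg.continuousOn_fderiv_of_isOpen hO le_rfl)

/-- Near a point where its derivative is injective, a map distorts distances by almost the same
factors as its derivative. -/
lemma exists_nhds_dist_le_mul_dist_fderiv {g : U → F} {L : U →L[ℝ] F} {x : U}
    (hg : HasStrictFDerivAt g L x) (hL : Function.Injective L) {c : ℝ≥0} (hc : 1 < c) :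
    ∃ V ∈ 𝓝 x, ∀ y ∈ V, ∀ z ∈ V, dist (g y) (g z) ≤ c * dist (L y) (L z) ∧
      dist (L y) (L z) ≤ c * dist (g y) (g z) := by
  obtain ⟨K, hK, hKL⟩ := (L : U →ₗ[ℝ] F).exists_antilipschitzWith
    (LinearMap.ker_eq_bot.2 hL)
  have hc' : (1 : ℝ) < c := by exact_mod_cast hc
  have hc0 : (0 : ℝ) < c := by linarith
  -- with `ε = 1 - 1/c`, both `1 + ε ≤ c` and `1 / (1 - ε) = c`
  have hε : 0 < 1 - (c : ℝ)⁻¹ := by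
    have := inv_lt_one_of_one_lt₀ hc'
    linarith
  obtain ⟨V, hV, hVg⟩ := hg.approximates_deriv_on_nhds
    (c := Real.toNNReal ((1 - (c : ℝ)⁻¹) / K)) (Or.inr (Real.toNNReal_pos.2 (by positivity)))
  refine ⟨V, hV, fun y hy z hz => ?_⟩
  have h1 := hVg y hy z hz
  have h2 : ‖y - z‖ ≤ K * ‖L y - L z‖ := by
    have := hKL.le_mul_dist y z
    simpa [dist_eq_norm] using this
  have h3 : ‖g y - g z - L (y - z)‖ ≤ (1 - (c : ℝ)⁻¹) * ‖L y - L z‖ := by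
    refine h1.trans ?_
    rw [Real.coe_toNNReal _ (by positivity)]
    calc (1 - (c : ℝ)⁻¹) / K * ‖y - z‖ ≤ (1 - (c : ℝ)⁻¹) / K * (K * ‖L y - L z‖) := by gcongr
      _ = _ := by field_simp
  rw [map_sub] at h3
  rw [dist_eq_norm, dist_eq_norm]
  set A := ‖L y - L z‖
  set G := ‖g y - g z‖
  have h4 : G ≤ A + (1 - (c : ℝ)⁻¹) * A := by
    have := norm_le_norm_add_norm_sub (L y - L z) (g y - g z)
    linarith [norm_sub_rev (L y - L z) (g y - g z)]
  have h5 : A ≤ G + (1 - (c : ℝ)⁻¹) * A := by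
    have := norm_le_norm_add_norm_sub (g y - g z) (L y - L z)
    linarith [norm_sub_rev (L y - L z) (g y - g z)]
  have hA : 0 ≤ A := norm_nonneg _
  constructor
  · refine h4.trans ?_
    have : 2 - (c : ℝ)⁻¹ ≤ c := by
      have : 0 ≤ (c - 1) ^ 2 / (c : ℝ) := by positivity
      have e : (c - 1) ^ 2 / (c : ℝ) = c - 2 + (c : ℝ)⁻¹ := by field_simp; ring
      linarith
    nlinarith
  · have : (c : ℝ)⁻¹ * A ≤ G := by linarith
    calc A = c * ((c : ℝ)⁻¹ * A) := by field_simp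
      _ ≤ c * G := by gcongr

lemma le_of_forall_one_lt_le_pow_mul {a b : ℝ≥0∞} (n : ℕ)
    (h : ∀ c : ℝ≥0, 1 < c → a ≤ (c : ℝ≥0∞) ^ n * b) : a ≤ b := by
  have ht : Tendsto (fun c : ℝ≥0 => (c : ℝ≥0∞) ^ n * b) (𝓝[>] 1) (𝓝 (((1 : ℝ≥0) : ℝ≥0∞) ^ n * b)) := by
    refine Tendsto.mono_left ?_ nhdsWithin_le_nhds
    refine ENNReal.Tendsto.mul_const ?_ (Or.inl (by simp))
    exact ((ENNReal.continuous_pow n).comp ENNReal.continuous_coe).tendsto 1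
  have := ge_of_tendsto ht (eventually_nhdsWithin_of_forall fun c hc => h c hc)
  simpa using this

variable [MeasurableSpace U] [BorelSpace U] [MeasurableSpace F] [BorelSpace F]

/-- On small sets, the area of the image and the integral of the Jacobian agree up to a factor close
to one. -/
lemma exists_nhds_area_le {g : U → F} {O : Set U} (hO : IsOpen O) (hg : ContDiffOn ℝ 1 g O)
    {x : U} (hx : x ∈ O) (hJ : areaJacobian g x ≠ 0) {c : ℝ≥0} (hc : 1 < c) :
    ∃ V ∈ 𝓝 x, V ⊆ O ∧ InjOn g V ∧ ∀ s ⊆ V, MeasurableSet s →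
      μHE[finrank ℝ U] (g '' s) ≤
        (c : ℝ≥0∞) ^ (finrank ℝ U + 1) * ∫⁻ y in s, ENNReal.ofReal (areaJacobian g y) ∧
      ∫⁻ y in s, ENNReal.ofReal (areaJacobian g y) ≤
        (c : ℝ≥0∞) ^ (finrank ℝ U + 1) * μHE[finrank ℝ U] (g '' s) := by
  have hLinj : Function.Injective (fderiv ℝ g x) := injective_of_normDet_ne_zero hJ
  obtain ⟨V, hV, hVd⟩ := exists_nhds_dist_le_mul_dist_fderiv
    ((hg.contDiffAt (hO.mem_nhds hx)).hasStrictFDerivAt one_ne_zero) hLinj hc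
  set J := areaJacobian g x with hJdef
  have hJpos : 0 < J := (areaJacobian_nonneg g x).lt_of_ne' hJ
  have hc' : (1 : ℝ) < c := by exact_mod_cast hc
  have hcont : ContinuousAt (areaJacobian g) x :=
    (continuousOn_areaJacobian hO hg).continuousAt (hO.mem_nhds hx)
  have h1 : ∀ᶠ y in 𝓝 x, areaJacobian g y < c * J :=
    hcont.eventually (gt_mem_nhds (by nlinarith))
  have h2 : ∀ᶠ y in 𝓝 x, J / c < areaJacobian g y :=
    hcont.eventually (lt_mem_nhds (div_lt_self hJpos hc'))
  refine ⟨V ∩ O ∩ {y | areaJacobian g y < c * J} ∩ {y | J / c < areaJacobian g y}, ?_, ?_, ?_, ?_⟩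
  · exact inter_mem (inter_mem (inter_mem hV (hO.mem_nhds hx)) h1) h2
  · exact fun y hy => hy.1.1.2
  · intro y hy z hz hyz
    have := (hVd y hy.1.1.1 z hz.1.1.1).2
    rw [hyz, dist_self, mul_zero] at this
    exact hLinj (dist_le_zero.1 this)
  · intro s hs hsm
    have hlin : μHE[finrank ℝ U] (fderiv ℝ g x '' s) = ENNReal.ofReal J * volume s :=
      (fderiv ℝ g x : U →ₗ[ℝ] F).euclideanHausdorffMeasure_image_eq_normDet_mul_volume s
    have hle1 : ENNReal.ofReal J * volume s ≤
        c * ∫⁻ y in s, ENNReal.ofReal (areaJacobian g y) := by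
      rw [← lintegral_const_mul' _ _ (by simp), ← setLIntegral_const]
      refine setLIntegral_mono' hsm fun y hy => ?_
      rw [← ENNReal.ofReal_coe_nnreal, ← ENNReal.ofReal_mul (by positivity)]
      refine ENNReal.ofReal_le_ofReal ?_
      have : J / c < areaJacobian g y := (hs hy).2
      rw [div_lt_iff₀ (by linarith)] at this
      linarith
    have hle2 : ∫⁻ y in s, ENNReal.ofReal (areaJacobian g y) ≤
        c * (ENNReal.ofReal J * volume s) := by
      rw [← mul_assoc, ← ENNReal.ofReal_coe_nnreal, ← ENNReal.ofReal_mul (by positivity),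
        ← setLIntegral_const]
      refine setLIntegral_mono' hsm fun y hy => ENNReal.ofReal_le_ofReal ?_
      exact (show areaJacobian g y < c * J from (hs hy).1.2).le
    constructor
    · refine (euclideanHausdorffMeasure_image_le_of_dist_le (q := fderiv ℝ g x) (C := c) _
        fun y hy z hz => (hVd y (hs hy).1.1.1 z (hs hz).1.1.1).1).trans ?_
      rw [hlin, pow_succ, mul_assoc]
      gcongr
    · have := euclideanHausdorffMeasure_image_le_of_dist_le (p := fderiv ℝ g x) (q := g) (C := c)
        (finrank ℝ U) fun y hy z hz => (hVd y (hs hy).1.1.1 z (hs hz).1.1.1).2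
      rw [hlin] at this
      rw [pow_succ', mul_assoc]
      exact hle2.trans (by gcongr)

lemma measurableSet_image_of_injOn {g : U → F} {O B : Set U} (hg : ContDiffOn ℝ 1 g O)
    (hBO : B ⊆ O) (hB : MeasurableSet B) (hinj : InjOn g B) : MeasurableSet (g '' B) :=
  have : ProperSpace U := FiniteDimensional.proper_real U
  hB.image_of_continuousOn_injOn (hg.continuousOn.mono hBO) hinj

/-- The area formula for injective immersions. -/
theorem euclideanHausdorffMeasure_image_eq_lintegral_areaJacobian {g : U → F} {O B : Set U}
    (hO : IsOpen O) (hg : ContDiffOn ℝ 1 g O) (hBO : B ⊆ O) (hB : MeasurableSet B)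
    (hinj : InjOn g B) (hJ : ∀ x ∈ B, areaJacobian g x ≠ 0) :
    μHE[finrank ℝ U] (g '' B) = ∫⁻ x in B, ENNReal.ofReal (areaJacobian g x) := by
  have : ProperSpace U := FiniteDimensional.proper_real U
  have key : ∀ c : ℝ≥0, 1 < c → μHE[finrank ℝ U] (g '' B) ≤
        (c : ℝ≥0∞) ^ (finrank ℝ U + 1) * ∫⁻ y in B, ENNReal.ofReal (areaJacobian g y) ∧
      ∫⁻ y in B, ENNReal.ofReal (areaJacobian g y) ≤
        (c : ℝ≥0∞) ^ (finrank ℝ U + 1) * μHE[finrank ℝ U] (g '' B) := by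
    intro c hc
    choose! V hV hVO hVinj hVle using
      fun x (hx : x ∈ B) => exists_nhds_area_le hO hg (hBO hx) (hJ x hx) hc
    obtain ⟨A, hAm, hAd, hBA, hAV⟩ := exists_countable_measurable_partition hB hV
    have hAB : ∀ n, A n ⊆ B := fun n => hBA ▸ subset_iUnion A n
    have hle : ∀ n, μHE[finrank ℝ U] (g '' A n) ≤
        (c : ℝ≥0∞) ^ (finrank ℝ U + 1) * ∫⁻ y in A n, ENNReal.ofReal (areaJacobian g y) ∧
      ∫⁻ y in A n, ENNReal.ofReal (areaJacobian g y) ≤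
        (c : ℝ≥0∞) ^ (finrank ℝ U + 1) * μHE[finrank ℝ U] (g '' A n) := by
      intro n
      rcases hAV n with h | ⟨x, hx, h⟩
      · simp [h]
      · exact hVle x hx _ h (hAm n)
    have e1 : μHE[finrank ℝ U] (g '' B) = ∑' n, μHE[finrank ℝ U] (g '' A n) := by
      conv_lhs => rw [hBA, image_iUnion]
      refine measure_iUnion (fun i j hij => ?_) fun n =>
        measurableSet_image_of_injOn hg ((hAB n).trans hBO) (hAm n) (hinj.mono (hAB n))
      exact disjoint_image_image fun x hx y hy hxy => (hAd hij).ne_of_mem hx hy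
        (hinj (hAB i hx) (hAB j hy) hxy)
    have e2 : ∫⁻ y in B, ENNReal.ofReal (areaJacobian g y) =
        ∑' n, ∫⁻ y in A n, ENNReal.ofReal (areaJacobian g y) := by
      conv_lhs => rw [hBA]
      exact lintegral_iUnion hAm hAd _
    rw [e1, e2, ← ENNReal.tsum_mul_left, ← ENNReal.tsum_mul_left]
    exact ⟨ENNReal.tsum_le_tsum fun n => (hle n).1, ENNReal.tsum_le_tsum fun n => (hle n).2⟩
  exact le_antisymm (le_of_forall_one_lt_le_pow_mul _ fun c hc => (key c hc).1)
    (le_of_forall_one_lt_le_pow_mul _ fun c hc => (key c hc).2)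

theorem lintegral_image_eq_lintegral_areaJacobian_mul {g : U → F} {O B : Set U}
    (hO : IsOpen O) (hg : ContDiffOn ℝ 1 g O) (hBO : B ⊆ O) (hB : MeasurableSet B)
    (hinj : InjOn g B) (hJ : ∀ x ∈ B, areaJacobian g x ≠ 0) {f : F → ℝ≥0∞} (hf : Measurable f) :
    ∫⁻ y in g '' B, f y ∂μHE[finrank ℝ U] =
      ∫⁻ x in B, ENNReal.ofReal (areaJacobian g x) * f (g x) := by
  have hgm : AEMeasurable g (volume.restrict B) := (hg.continuousOn.mono hBO).aemeasurable hB
  have hJm : AEMeasurable (fun x => ENNReal.ofReal (areaJacobian g x)) (volume.restrict B) :=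
    (((continuousOn_areaJacobian hO hg).mono hBO).aemeasurable hB).ennreal_ofReal
  set ν := (volume.restrict B).withDensity fun x => ENNReal.ofReal (areaJacobian g x) with hν
  have hgν : AEMeasurable g ν := hgm.mono_ac (withDensity_absolutelyContinuous _ _)
  have hmap : (μHE[finrank ℝ U]).restrict (g '' B) = ν.map g := by
    ext T hT
    have hm : MeasurableSet (B ∩ g ⁻¹' T) := by
      have := hB.subtype_image ((hg.continuousOn.mono hBO).domRestrict.measurable hT)
      rwa [domRestrict_eq, preimage_comp, Subtype.image_preimage_coe] at this
    rw [Measure.restrict_apply hT, Measure.map_apply_of_aemeasurable hgν hT, inter_comm, ← image_inter_preimage,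
      euclideanHausdorffMeasure_image_eq_lintegral_areaJacobian hO hg (inter_subset_left.trans hBO)
        hm (hinj.mono inter_subset_left) fun x hx => hJ x hx.1]
    have : ν (g ⁻¹' T) = ν (B ∩ g ⁻¹' T) := by
      rw [inter_comm]; refine (measure_inter_conull ?_).symm
      rw [hν]
      refine withDensity_absolutelyContinuous _ _ ?_
      rw [Measure.restrict_apply hB.compl]
      simp
    rw [this, hν, withDensity_apply _ hm, Measure.restrict_restrict hm,
      inter_eq_left.2 inter_subset_left]
  rw [hmap, lintegral_map' hf.aemeasurable hgν, hν]
  exact lintegral_withDensity_eq_lintegral_mul₀' hJm (hf.comp_aemeasurable hgν)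

end AreaFormula

/-! ### Counting preimages -/

section Count

variable {X Y E : Type*} {f : X → E}

lemma preimageCount_mono {A B : Set X} (h : A ⊆ B) (y : E) :
    preimageCount f A y ≤ preimageCount f B y := by
  unfold preimageCount
  exact ENat.toENNReal_mono (encard_le_encard fun p hp => ⟨h hp.1, hp.2⟩)

lemma preimageCount_iUnion {A : ℕ → Set X} (hA : Pairwise (Function.onFun Disjoint A)) (y : E) :
    preimageCount f (⋃ n, A n) y = ∑' n, preimageCount f (A n) y := by
  -- countable additivity of the counting measure on the σ-algebra of all subsets
  let _ : MeasurableSpace X := ⊤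
  have h : ∀ s : Set X, ((s.encard : ℕ∞) : ℝ≥0∞) = Measure.count s :=
    fun s => (Measure.count_apply (MeasurableSpace.measurableSet_top)).symm
  unfold preimageCount
  simp_rw [h]
  rw [← measure_iUnion]
  · congr 1
    ext p
    simp
  · intro i j hij
    exact (hA hij).mono (fun p hp => hp.1) fun p hp => hp.1
  · exact fun _ => MeasurableSpace.measurableSet_top

lemma preimageCount_union_le (A B : Set X) (y : E) :
    preimageCount f (A ∪ B) y ≤ preimageCount f A y + preimageCount f B y := by
  unfold preimageCount
  rw [← ENat.toENNReal_add]
  gcongr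
  refine (encard_le_encard ?_).trans (encard_union_le _ _)
  rintro p ⟨hp | hp, h⟩
  exacts [Or.inl ⟨hp, h⟩, Or.inr ⟨hp, h⟩]

lemma preimageCount_eq_zero {A : Set X} {y : E} (hy : y ∉ f '' A) : preimageCount f A y = 0 := by
  unfold preimageCount
  have : {p | p ∈ A ∧ f p = y} = ∅ :=
    eq_empty_of_forall_notMem fun p hp => hy ⟨p, hp.1, hp.2⟩
  rw [this]
  simp

lemma preimageCount_eq_indicator {A : Set X} (h : InjOn f A) (y : E) :
    preimageCount f A y = (f '' A).indicator 1 y := by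
  by_cases hy : y ∈ f '' A
  · obtain ⟨x, hx, rfl⟩ := hy
    unfold preimageCount
    have : {p | p ∈ A ∧ f p = f x} = {x} := by
      ext p
      exact ⟨fun hp => h hp.1 hx hp.2, by rintro rfl; exact ⟨hx, rfl⟩⟩
    rw [this, indicator_of_mem (mem_image_of_mem f hx)]
    simp
  · rw [preimageCount_eq_zero hy, indicator_of_notMem hy]

lemma indicator_image_le_preimageCount (A : Set X) (y : E) :
    (f '' A).indicator 1 y ≤ preimageCount f A y := by
  refine indicator_le' (fun z hz => ?_) (fun _ _ => zero_le) y
  obtain ⟨x, hx, rfl⟩ := hz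
  unfold preimageCount
  have : (1 : ℕ∞) ≤ {p | p ∈ A ∧ f p = f x}.encard := by
    rw [one_le_encard_iff_nonempty]
    exact ⟨x, hx, rfl⟩
  simpa using ENat.toENNReal_mono this

/-- A bijective change of parameters does not change the number of preimages. -/
lemma preimageCount_comp_of_injOn {φ : Y → X} {B : Set Y} (h : InjOn φ B) (y : E) :
    preimageCount (f ∘ φ) B y = preimageCount f (φ '' B) y := by
  unfold preimageCount
  have : {p | p ∈ φ '' B ∧ f p = y} = φ '' {q | q ∈ B ∧ (f ∘ φ) q = y} := by
    ext p
    constructor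
    · rintro ⟨⟨q, hq, rfl⟩, h⟩
      exact ⟨q, ⟨hq, h⟩, rfl⟩
    · rintro ⟨q, ⟨hq, h⟩, rfl⟩
      exact ⟨⟨q, hq, rfl⟩, h⟩
  rw [this, (h.mono fun q hq => hq.1).encard_image]

lemma preimageCount_congr {g : X → E} {A : Set X} (h : EqOn f g A) (y : E) :
    preimageCount f A y = preimageCount g A y := by
  unfold preimageCount
  congr 2
  ext p
  exact and_congr_right fun hp => by rw [h hp]

lemma measurableSet_image_closed_inter_open {X E : Type*} [TopologicalSpace X]
    [TopologicalSpace.MetrizableSpace X] [SigmaCompactSpace X] [TopologicalSpace E] [T2Space E]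
    [MeasurableSpace E] [BorelSpace E] {f : X → E} {K O : Set X} (hK : IsClosed K) (hO : IsOpen O)
    (hf : ContinuousOn f (K ∩ O)) : MeasurableSet (f '' (K ∩ O)) := by
  let _ := TopologicalSpace.metrizableSpaceMetric X
  obtain ⟨C, hC, -, hCO, -⟩ := hO.exists_iUnion_isClosed
  have hs : IsSigmaCompact (K ∩ O) := by
    rw [← hCO, inter_iUnion]
    exact isSigmaCompact_iUnion _ fun n => isSigmaCompact_univ.of_isClosed_subset (hK.inter (hC n)) (subset_univ _)
  obtain ⟨L, hL, hLe⟩ := hs.image_of_continuousOn hf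
  rw [← hLe]
  exact MeasurableSet.iUnion fun n => (hL n).isClosed.measurableSet

/-- The number of preimages is a supremum, over finite families of pairwise disjoint basic open
sets, of the number of members of the family whose image contains the point. -/
lemma measurable_preimageCount_closed_inter_open {X E : Type*} [TopologicalSpace X]
    [TopologicalSpace.MetrizableSpace X] [SigmaCompactSpace X] [SecondCountableTopology X] [TopologicalSpace E]
    [T2Space E] [MeasurableSpace E] [BorelSpace E] {f : X → E} {K O : Set X} (hK : IsClosed K)
    (hO : IsOpen O) (hf : ContinuousOn f (K ∩ O)) : Measurable (preimageCount f (K ∩ O)) := by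
  classical
  set b := TopologicalSpace.countableBasis X with hb
  have hbb : TopologicalSpace.IsTopologicalBasis b := TopologicalSpace.isBasis_countableBasis X
  have : Countable b := (TopologicalSpace.countable_countableBasis X).to_subtype
  set c : Finset b → E → ℝ≥0∞ := fun T y => ∑ V ∈ T, (f '' (K ∩ (O ∩ V.1))).indicator 1 y with hc
  have hcm : ∀ T, Measurable (c T) := by
    intro T
    refine Finset.measurable_sum _ fun V _ => measurable_one.indicator ?_
    exact measurableSet_image_closed_inter_open hK (hO.inter (hbb.isOpen V.2))
      (hf.mono (inter_subset_inter_right _ inter_subset_left))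
  have heq : preimageCount f (K ∩ O) = fun y =>
      ⨆ (T : Finset b) (_ : (T : Set b).PairwiseDisjoint fun V => (V : Set X)), c T y := by
    ext y
    apply le_antisymm
    · have hfin : ∀ s : Finset X, (∀ p ∈ s, p ∈ K ∩ O ∧ f p = y) → (s.card : ℝ≥0∞) ≤
          ⨆ (T : Finset b) (_ : (T : Set b).PairwiseDisjoint fun V => (V : Set X)), c T y := by
        intro s hs
        obtain ⟨V, hV, hVd⟩ := s.finite_toSet.t2_separation
        have : ∀ p : X, ∃ W : b, p ∈ W.1 ∧ W.1 ⊆ V p := fun p => by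
          obtain ⟨W, hW, hpW, hWV⟩ := hbb.exists_subset_of_mem_open (hV p).1 (hV p).2
          exact ⟨⟨W, hW⟩, hpW, hWV⟩
        choose W hpW hWV using this
        have hWinj : InjOn W s := by
          intro p hp q hq hpq
          by_contra hne
          refine disjoint_left.1 (hVd hp hq hne) (hWV p (hpW p)) (hWV q ?_)
          rw [← hpq]
          exact hpW p
        refine le_iSup₂_of_le (s.image W) ?_ ?_
        · rintro _ hA _ hB hne
          simp only [Finset.coe_image, mem_image, Finset.mem_coe] at hA hB
          obtain ⟨p, hp, rfl⟩ := hA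
          obtain ⟨q, hq, rfl⟩ := hB
          exact (hVd hp hq fun h => hne (by rw [h])).mono (hWV p) (hWV q)
        · rw [hc]
          simp only
          rw [Finset.sum_image hWinj, Finset.card_eq_sum_ones, Nat.cast_sum]
          refine Finset.sum_le_sum fun p hp => ?_
          have hy : y ∈ f '' (K ∩ (O ∩ (W p).1)) :=
            ⟨p, ⟨(hs p hp).1.1, (hs p hp).1.2, hpW p⟩, (hs p hp).2⟩
          rw [indicator_of_mem hy]
          simp
      unfold preimageCount
      set A := {p | p ∈ K ∩ O ∧ f p = y}
      by_cases hA : A.Finite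
      · rw [hA.encard_eq_coe_toFinset_card]
        simpa using hfin hA.toFinset fun p hp => hA.mem_toFinset.1 hp
      · refine le_of_eq_of_le ?_ (ENNReal.iSup_natCast.symm.le.trans (iSup_le fun n => ?_))
        · rw [Set.Infinite.encard_eq hA]
          rfl
        · obtain ⟨s, hsA, hsn⟩ := Set.Infinite.exists_subset_card_eq hA n
          rw [← hsn]
          exact hfin s fun p hp => hsA hp
    · refine iSup₂_le fun T hT => ?_
      rw [hc]
      simp only
      calc ∑ V ∈ T, (f '' (K ∩ (O ∩ V.1))).indicator 1 y
          ≤ ∑ V ∈ T, preimageCount f (K ∩ (O ∩ V.1)) y :=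
            Finset.sum_le_sum fun V _ => indicator_image_le_preimageCount _ _
        _ ≤ preimageCount f (K ∩ O) y := by
            let _ : MeasurableSpace X := ⊤
            have h : ∀ s : Set X, ((s.encard : ℕ∞) : ℝ≥0∞) = Measure.count s :=
              fun s => (Measure.count_apply (MeasurableSpace.measurableSet_top)).symm
            unfold preimageCount
            simp_rw [h]
            rw [← measure_biUnion_finset]
            · refine measure_mono ?_
              simp only [iUnion_subset_iff]
              exact fun V _ p hp => ⟨⟨hp.1.1, hp.1.2.1⟩, hp.2⟩
            · intro V hV W hW hne
              exact (hT hV hW hne).mono (fun p hp => hp.1.2.2) fun p hp => hp.1.2.2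
            · exact fun _ _ => MeasurableSpace.measurableSet_top
  rw [heq]
  exact Measurable.iSup fun T => Measurable.iSup fun _ => hcm T

end Count

section AreaFormula

variable {U F : Type*} [NormedAddCommGroup U] [InnerProductSpace ℝ U] [FiniteDimensional ℝ U]
  [NormedAddCommGroup F] [InnerProductSpace ℝ F]
  [MeasurableSpace U] [BorelSpace U] [MeasurableSpace F] [BorelSpace F]

/-- The area formula for immersions, with multiplicity. -/
theorem lintegral_preimageCount_eq_lintegral_areaJacobian_mul {g : U → F} {O B : Set U}
    (hO : IsOpen O) (hg : ContDiffOn ℝ 1 g O) (hBO : B ⊆ O) (hB : MeasurableSet B)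
    (hJ : ∀ x ∈ B, areaJacobian g x ≠ 0) {f : F → ℝ≥0∞} (hf : Measurable f) :
    Measurable (preimageCount g B) ∧
    ∫⁻ y, preimageCount g B y * f y ∂μHE[finrank ℝ U] =
      ∫⁻ x in B, ENNReal.ofReal (areaJacobian g x) * f (g x) := by
  have : ProperSpace U := FiniteDimensional.proper_real U
  choose! V hV hVO hVinj hVle using
    fun x (hx : x ∈ B) => exists_nhds_area_le hO hg (hBO hx) (hJ x hx) one_lt_two
  obtain ⟨A, hAm, hAd, hBA, hAV⟩ := exists_countable_measurable_partition hB hV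
  have hAB : ∀ n, A n ⊆ B := fun n => hBA ▸ subset_iUnion A n
  have hAinj : ∀ n, InjOn g (A n) := by
    intro n
    rcases hAV n with h | ⟨x, hx, h⟩
    · simp [h]
    · exact (hVinj x hx).mono h
  have hAi : ∀ n, MeasurableSet (g '' A n) := fun n =>
    measurableSet_image_of_injOn hg ((hAB n).trans hBO) (hAm n) (hAinj n)
  have hcount : preimageCount g B = fun y => ∑' n, (g '' A n).indicator 1 y := by
    ext y
    conv_lhs => rw [hBA]
    rw [preimageCount_iUnion hAd]
    exact tsum_congr fun n => preimageCount_eq_indicator (hAinj n) y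
  have hcm : ∀ n, Measurable ((g '' A n).indicator (1 : F → ℝ≥0∞)) :=
    fun n => measurable_one.indicator (hAi n)
  refine ⟨hcount ▸ Measurable.tsum hcm, ?_⟩
  rw [hcount]
  simp_rw [← ENNReal.tsum_mul_right]
  rw [lintegral_tsum (f := fun n y => (g '' A n).indicator 1 y * f y)
    fun n => ((hcm n).mul hf).aemeasurable]
  conv_rhs => rw [hBA]
  rw [lintegral_iUnion hAm hAd]
  refine tsum_congr fun n => ?_
  rw [← lintegral_image_eq_lintegral_areaJacobian_mul hO hg ((hAB n).trans hBO) (hAm n)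
    (hAinj n) (fun x hx => hJ x (hAB n hx)) hf, ← lintegral_indicator (hAi n)]
  refine lintegral_congr fun y => ?_
  by_cases hy : y ∈ g '' A n <;> simp [hy]

end AreaFormula

/-! ### Parametrized patches of a submanifold -/

/-- `A` is the injective image of a Borel subset `U` of `ℝ^k` under a `C¹` immersion `ψ` of an open
set `O ⊇ U`. -/
def IsPatch {E : Type*} [NormedAddCommGroup E] [InnerProductSpace ℝ E] (k : ℕ) (A : Set E) : Prop :=
  ∃ (ψ : EuclideanSpace ℝ (Fin k) → E) (O U : Set (EuclideanSpace ℝ (Fin k))),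
    IsOpen O ∧ ContDiffOn ℝ 1 ψ O ∧ (∀ u ∈ O, areaJacobian ψ u ≠ 0) ∧
      U ⊆ O ∧ MeasurableSet U ∧ InjOn ψ U ∧ ψ '' U = A

section Patch

variable {E : Type*} [NormedAddCommGroup E] [InnerProductSpace ℝ E] [MeasurableSpace E]
  [BorelSpace E]

lemma IsPatch.measurableSet {k : ℕ} {A : Set E} (h : IsPatch k A) : MeasurableSet A := by
  obtain ⟨ψ, O, U, -, hψ, -, hUO, hU, hinj, rfl⟩ := h
  exact measurableSet_image_of_injOn hψ hUO hU hinj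

lemma IsPatch.hausdorffMeasure_succ_eq_zero {k : ℕ} {A : Set E} (h : IsPatch k A) :
    μHE[k + 1] A = 0 := by
  obtain ⟨ψ, O, U, hO, hψ, -, hUO, hU, hinj, rfl⟩ := h
  have hd : dimH (ψ '' U) ≤ k := by
    refine (dimH_image_le_of_locally_lipschitzOn fun u hu => ?_).trans
      ((dimH_mono (subset_univ U)).trans ?_)
    · obtain ⟨K, t, ht, hK⟩ := (hψ.contDiffAt (hO.mem_nhds (hUO hu))).exists_lipschitzOnWith
      exact ⟨K, t, mem_nhdsWithin_of_mem_nhds ht, hK⟩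
    · rw [Real.dimH_univ_eq_finrank]
      simp
  have : μH[((k + 1 : ℝ≥0) : ℝ)] (ψ '' U) = 0 := hausdorffMeasure_of_dimH_lt (hd.trans_lt (by
    exact_mod_cast Nat.lt_succ_self k))
  rw [Measure.euclideanHausdorffMeasure_def, Measure.smul_apply]
  push_cast at this ⊢
  rw [this, smul_zero]

end Patch

section Patches

variable {E : Type*} [NormedAddCommGroup E] [InnerProductSpace ℝ E] [FiniteDimensional ℝ E]

lemma IsEmbeddedSubmanifold.exists_immersion {k : ℕ} {S : Set E} (hS : IsEmbeddedSubmanifold k S)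
    {x : E} (hx : x ∈ S) :
    ∃ (ψ : EuclideanSpace ℝ (Fin k) → E) (O : Set (EuclideanSpace ℝ (Fin k))) (V : Set E),
      IsOpen O ∧ ContDiffOn ℝ 1 ψ O ∧ (∀ u ∈ O, areaJacobian ψ u ≠ 0) ∧ InjOn ψ O ∧ IsOpen V ∧
        x ∈ V ∧ ψ '' O = V ∩ S := by
  obtain ⟨e, W, hxe, he, hes, hW, heW⟩ := hS x hx
  let ℓ : EuclideanSpace ℝ (Fin k) ≃L[ℝ] W := ContinuousLinearEquiv.ofFinrankEq (by simp [hW])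
  let j : EuclideanSpace ℝ (Fin k) →L[ℝ] E := W.subtypeL ∘L ℓ.toContinuousLinearMap
  have hj : Function.Injective j := Subtype.val_injective.comp ℓ.injective
  have hO : IsOpen (j ⁻¹' e.target) := e.open_target.preimage j.continuous
  have hψ : ContDiffOn ℝ 1 (e.symm ∘ j) (j ⁻¹' e.target) :=
    (hes.of_le (by simp)).comp j.contDiff.contDiffOn fun u hu => hu
  refine ⟨e.symm ∘ j, j ⁻¹' e.target, e.source, hO, hψ, ?_, ?_, e.open_source, hxe, ?_⟩
  · intro u hu
    -- `e ∘ ψ = j` near `u`, so the derivative of `ψ` is injective because that of `j` is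
    have h1 : HasFDerivAt (e.symm ∘ j) (fderiv ℝ (e.symm ∘ j) u) u :=
      ((hψ.contDiffAt (hO.mem_nhds hu)).differentiableAt one_ne_zero).hasFDerivAt
    have hsrc : e.symm (j u) ∈ e.source := e.map_target hu
    have h2 : HasFDerivAt e (fderiv ℝ e (e.symm (j u))) ((e.symm ∘ j) u) :=
      ((he.contDiffAt (e.open_source.mem_nhds hsrc)).differentiableAt (by simp)).hasFDerivAt
    have h3 : HasFDerivAt j ((fderiv ℝ e (e.symm (j u))).comp (fderiv ℝ (e.symm ∘ j) u)) u :=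
      (h2.comp u h1).congr_of_eventuallyEq
        (eventuallyEq_of_mem (hO.mem_nhds hu) fun w hw => (e.right_inv hw).symm)
    have h4 := h3.unique j.hasFDerivAt
    refine (normDet_pos_of_injective fun a b hab => hj ?_).ne'
    rw [← h4]
    exact congrArg (fderiv ℝ e (e.symm (j u))) hab
  · exact fun u hu v hv huv => hj (e.symm.injOn hu hv huv)
  · ext y
    constructor
    · rintro ⟨u, hu, rfl⟩
      have : j u ∈ e '' (e.source ∩ S) := heW ▸ ⟨hu, (ℓ u).2⟩
      obtain ⟨z, hz, hzu⟩ := this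
      have : (e.symm ∘ j) u = z := by
        rw [Function.comp_apply, ← hzu, e.left_inv hz.1]
      rwa [this]
    · intro hy
      have : e y ∈ e.target ∩ (W : Set E) := heW ▸ mem_image_of_mem e hy
      refine ⟨ℓ.symm ⟨e y, this.2⟩, ?_, ?_⟩
      · simpa [j] using this.1
      · simp [j, e.left_inv hy.1]

variable [MeasurableSpace E] [BorelSpace E]

lemma IsEmbeddedSubmanifold.exists_patches {k : ℕ} {S : Set E} (hS : IsEmbeddedSubmanifold k S)
    (hSm : MeasurableSet S) :
    ∃ A : ℕ → Set E, (∀ n, IsPatch k (A n)) ∧ Pairwise (Function.onFun Disjoint A) ∧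
      S = ⋃ n, A n := by
  have : ProperSpace E := FiniteDimensional.proper_real E
  choose! ψ O V hO hψ hJ hinj hV hxV hψO using fun x (hx : x ∈ S) => hS.exists_immersion hx
  obtain ⟨A, hAm, hAd, hSA, hAV⟩ := exists_countable_measurable_partition hSm
    (fun x hx => (hV x hx).mem_nhds (hxV x hx))
  refine ⟨A, fun n => ?_, hAd, hSA⟩
  rcases hAV n with h | ⟨x, hx, h⟩
  · exact ⟨0, ∅, ∅, isOpen_empty, contDiffOn_empty, by simp, subset_rfl, .empty, by simp, by simp [h]⟩
  · refine ⟨ψ x, O x, O x ∩ ψ x ⁻¹' A n, hO x hx, hψ x hx, hJ x hx, inter_subset_left, ?_,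
      (hinj x hx).mono inter_subset_left, ?_⟩
    · have := (hO x hx).measurableSet.subtype_image
        ((hψ x hx).continuousOn.domRestrict.measurable (hAm n))
      rwa [domRestrict_eq, preimage_comp, Subtype.image_preimage_coe] at this
    · rw [image_inter_preimage, hψO x hx, inter_eq_right]
      exact fun y hy => ⟨h hy, hSA ▸ mem_iUnion_of_mem n hy⟩

end Patches

/-! ### The Jacobian of a cone map and of its lift -/

section Jacobian

/-- The determinant is affine in the last diagonal entry, with slope the complementary minor. -/
lemma det_fromBlocks_add_unique {m : Type*} [Fintype m] [DecidableEq m] (A : Matrix m m ℝ)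
    (B : Matrix m Unit ℝ) (C : Matrix Unit m ℝ) (D D' : Matrix Unit Unit ℝ) (hA : A.det ≠ 0) :
    (Matrix.fromBlocks A B C (D + D')).det =
      (Matrix.fromBlocks A B C D).det + A.det * D' () () := by
  let _ := Matrix.invertibleOfIsUnitDet A (isUnit_iff_ne_zero.2 hA)
  rw [Matrix.det_fromBlocks₁₁, Matrix.det_fromBlocks₁₁, Matrix.det_unique (n := Unit),
    Matrix.det_unique (n := Unit)]
  simp only [Matrix.sub_apply, Matrix.add_apply]
  simp only [PUnit.default_eq_unit]
  ring

/-- If `G` adds to `C` an orthogonal component that is `c` times the last coordinate, then its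
volume factor is the hypotenuse of that of `C` and `|c|` times that of `C` on the first factor. -/
lemma normDet_sq_eq_add {K E F : Type*} [NormedAddCommGroup K] [InnerProductSpace ℝ K]
    [FiniteDimensional ℝ K] [NormedAddCommGroup E] [InnerProductSpace ℝ E] [NormedAddCommGroup F]
    [InnerProductSpace ℝ F] (C : WithLp 2 (K × ℝ) →ₗ[ℝ] E) (G : WithLp 2 (K × ℝ) →ₗ[ℝ] F)
    (T : K →ₗ[ℝ] E) (c : ℝ) (hT : ∀ w, C (WithLp.toLp 2 (w, 0)) = T w) (hT0 : T.normDet ≠ 0)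
    (hG : ∀ p q, inner ℝ (G p) (G q) = inner ℝ (C p) (C q) + c ^ 2 * p.snd * q.snd) :
    G.normDet ^ 2 = C.normDet ^ 2 + (c * T.normDet) ^ 2 := by
  let b := stdOrthonormalBasis ℝ K
  let b₁ : OrthonormalBasis Unit ℝ ℝ := OrthonormalBasis.singleton Unit ℝ
  have hGd := G.normDet_sq_eq_det_gram (b.prod b₁)
  have hCd := C.normDet_sq_eq_det_gram (b.prod b₁)
  have hTd := T.normDet_sq_eq_det_gram b
  simp only [RCLike.ofReal_real_eq_id, id_eq] at hGd hCd hTd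
  set A : Matrix _ _ ℝ := Matrix.gram ℝ fun i => T (b i) with hA
  have hA0 : A.det ≠ 0 := by rw [← hTd]; positivity
  set M : Matrix _ _ ℝ := Matrix.gram ℝ fun i => C ((b.prod b₁) i) with hM
  have hM11 : M.toBlocks₁₁ = A := by
    ext i j
    simp [hM, hA, Matrix.toBlocks₁₁, Matrix.gram_apply, ← hT]
  have hGM : Matrix.gram ℝ (fun i => G ((b.prod b₁) i)) =
      Matrix.fromBlocks A M.toBlocks₁₂ M.toBlocks₂₁ (M.toBlocks₂₂ + Matrix.of fun _ _ => c ^ 2) := by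
    rw [← hM11]
    ext (i | i) (j | j)
    · simp only [Matrix.gram_apply, hG]
      simp [hM, Matrix.toBlocks₁₁, Matrix.gram_apply]
    · simp only [Matrix.gram_apply, hG]
      simp [hM, Matrix.toBlocks₁₂, Matrix.gram_apply]
    · simp only [Matrix.gram_apply, hG]
      simp [hM, Matrix.toBlocks₂₁, Matrix.gram_apply]
    · simp only [Matrix.gram_apply, hG]
      simp [hM, Matrix.toBlocks₂₂, Matrix.gram_apply, b₁]
  rw [hGd, hGM, det_fromBlocks_add_unique _ _ _ _ _ hA0, mul_pow, hTd, hCd, ← hM11,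
    Matrix.fromBlocks_toBlocks]
  simp [mul_comm]

end Jacobian

/-! ### Points `(y, z)` of `ℝ^N × ℝ` and their Gaussian weights -/

section PairPoint

variable {N : ℕ}

lemma inner_pairPoint (x y : EuclideanSpace ℝ (Fin N)) (s t : ℝ) :
    inner ℝ (pairPoint x s) (pairPoint y t) = inner ℝ x y + s * t := by
  simp [pairPoint, PiLp.inner_apply, Fin.sum_univ_castSucc, mul_comm]

lemma norm_pairPoint_sq (x : EuclideanSpace ℝ (Fin N)) (s : ℝ) :
    ‖pairPoint x s‖ ^ 2 = ‖x‖ ^ 2 + s ^ 2 := by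
  rw [← real_inner_self_eq_norm_sq, inner_pairPoint, real_inner_self_eq_norm_sq]
  ring

/-- `pairPoint` as a continuous linear map `ℝ^N × ℝ → ℝ^{N+1}`. -/
noncomputable def pairCLM (N : ℕ) :
    EuclideanSpace ℝ (Fin N) × ℝ →L[ℝ] EuclideanSpace ℝ (Fin (N + 1)) :=
  LinearMap.toContinuousLinearMap
    { toFun := fun p => pairPoint p.1 p.2
      map_add' := fun p q => by
        ext i
        refine Fin.lastCases ?_ (fun i => ?_) i <;> simp [pairPoint]
      map_smul' := fun c p => by
        ext i
        refine Fin.lastCases ?_ (fun i => ?_) i <;> simp [pairPoint] }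

@[simp]
lemma pairCLM_apply (p : EuclideanSpace ℝ (Fin N) × ℝ) : pairCLM N p = pairPoint p.1 p.2 := rfl

end PairPoint

section Weight

variable {E : Type*} [NormedAddCommGroup E]

lemma gaussianWeight_nonneg (m : ℕ) (x : E) : 0 ≤ gaussianWeight m x := by
  unfold gaussianWeight
  positivity

lemma continuous_gaussianWeight (m : ℕ) : Continuous (gaussianWeight m : E → ℝ) := by
  unfold gaussianWeight
  fun_prop

lemma measurable_ofReal_gaussianWeight [MeasurableSpace E] [BorelSpace E] (m : ℕ) :
    Measurable fun x : E => ENNReal.ofReal (gaussianWeight m x) :=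
  (continuous_gaussianWeight m).measurable.ennreal_ofReal

lemma gaussianWeight_pairPoint {N : ℕ} (k : ℕ) (y : EuclideanSpace ℝ (Fin N)) (z : ℝ) :
    gaussianWeight (k + 1) (pairPoint y z) = gaussianWeight k y * gaussianWeight 1 z := by
  unfold gaussianWeight
  rw [norm_pairPoint_sq, Real.norm_eq_abs, sq_abs, mul_mul_mul_comm, ← Real.exp_add,
    ← Real.rpow_add (by positivity)]
  congr 2
  · push_cast
    ring
  · ring

lemma gaussianWeight_pairPoint_le {N : ℕ} (m : ℕ) (y : EuclideanSpace ℝ (Fin N)) (z : ℝ) :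
    gaussianWeight m (pairPoint y z) ≤ gaussianWeight m y := by
  unfold gaussianWeight
  rw [norm_pairPoint_sq]
  gcongr
  nlinarith [sq_nonneg z]

end Weight

/-! ### The area of the lift of a cone over a patch -/

/-- The lift of the cone map `(x, r) ↦ r x` to `ℝ^N × ℝ` with height `h r`. -/
noncomputable def coneLift {N : ℕ} (h : ℝ → ℝ) (p : EuclideanSpace ℝ (Fin N) × ℝ) :
    EuclideanSpace ℝ (Fin (N + 1)) :=
  pairPoint (coneMap p) (h p.2)

section ConeLift

variable {N : ℕ} {K : Type*} [NormedAddCommGroup K] [InnerProductSpace ℝ K]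

/-- The cone map in the parameters of a patch. -/
noncomputable def patchCone (ψ : K → EuclideanSpace ℝ (Fin N))
    (p : WithLp 2 (K × ℝ)) : EuclideanSpace ℝ (Fin N) :=
  p.snd • ψ p.fst

/-- The lift of the cone map in the parameters of a patch. -/
noncomputable def patchLift (ψ : K → EuclideanSpace ℝ (Fin N)) (h : ℝ → ℝ)
    (p : WithLp 2 (K × ℝ)) : EuclideanSpace ℝ (Fin (N + 1)) :=
  pairPoint (patchCone ψ p) (h p.snd)

variable {ψ : K → EuclideanSpace ℝ (Fin N)} {h h' : ℝ → ℝ}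
  {O : Set K}

lemma contDiffOn_patchCone (hψ : ContDiffOn ℝ 1 ψ O) :
    ContDiffOn ℝ 1 (patchCone ψ) {p | p.fst ∈ O ∧ p.snd ∈ Ioi 0} :=
  (WithLp.sndL 2 ℝ (K) ℝ).contDiff.contDiffOn.smul
    (hψ.comp (WithLp.fstL 2 ℝ (K) ℝ).contDiff.contDiffOn fun _ hp => hp.1)

lemma contDiffOn_patchLift (hψ : ContDiffOn ℝ 1 ψ O) (hh : ContDiffOn ℝ 1 h (Ioi 0)) :
    ContDiffOn ℝ 1 (patchLift ψ h) {p | p.fst ∈ O ∧ p.snd ∈ Ioi 0} :=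
  (pairCLM N).contDiff.comp_contDiffOn ((contDiffOn_patchCone hψ).prodMk
    (hh.comp (WithLp.sndL 2 ℝ (K) ℝ).contDiff.contDiffOn fun _ hp => hp.2))

lemma hasFDerivAt_patchCone (hO : IsOpen O) (hψ : ContDiffOn ℝ 1 ψ O) {p : WithLp 2 (K × ℝ)}
    (hp : p.fst ∈ O) :
    HasFDerivAt (patchCone ψ) (p.snd • (fderiv ℝ ψ p.fst).comp (WithLp.fstL 2 ℝ K ℝ) +
      (WithLp.sndL 2 ℝ K ℝ).smulRight (ψ p.fst)) p := by
  have h1 : HasFDerivAt ψ (fderiv ℝ ψ p.fst) (WithLp.fstL 2 ℝ K ℝ p) :=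
    ((hψ.contDiffAt (hO.mem_nhds hp)).differentiableAt one_ne_zero).hasFDerivAt
  exact (WithLp.sndL 2 ℝ K ℝ).hasFDerivAt.smul (h1.comp p (WithLp.fstL 2 ℝ K ℝ).hasFDerivAt)

lemma hasFDerivAt_patchLift {L : WithLp 2 (K × ℝ) →L[ℝ] EuclideanSpace ℝ (Fin N)}
    {p : WithLp 2 (K × ℝ)} (hC : HasFDerivAt (patchCone ψ) L p) {d : ℝ}
    (hd : HasDerivAt h d p.snd) :
    HasFDerivAt (patchLift ψ h) ((pairCLM N).comp (L.prod (d • WithLp.sndL 2 ℝ K ℝ))) p := by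
  have h2 : HasDerivAt h d (WithLp.sndL 2 ℝ K ℝ p) := hd
  exact (pairCLM N).hasFDerivAt.comp p
    (hC.prodMk (h2.comp_hasFDerivAt p (WithLp.sndL 2 ℝ K ℝ).hasFDerivAt))

/-- The Jacobian of the lift of a cone is the hypotenuse of the Jacobian of the cone and that of the
product of the dilated patch with the graph of the height. -/
lemma areaJacobian_patchLift_sq [FiniteDimensional ℝ K] (hO : IsOpen O) (hψ : ContDiffOn ℝ 1 ψ O)
    (hJ : ∀ u ∈ O, areaJacobian ψ u ≠ 0) {p : WithLp 2 (K × ℝ)}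
    (hp : p.fst ∈ O) (hr : 0 < p.snd) {d : ℝ} (hd : HasDerivAt h d p.snd) :
    areaJacobian (patchLift ψ h) p ^ 2 = areaJacobian (patchCone ψ) p ^ 2 +
      (d * (p.snd ^ finrank ℝ K * areaJacobian ψ p.fst)) ^ 2 := by
  have hC := hasFDerivAt_patchCone hO hψ hp
  have hG := hasFDerivAt_patchLift hC hd
  set L := p.snd • (fderiv ℝ ψ p.fst).comp (WithLp.fstL 2 ℝ K ℝ) +
      (WithLp.sndL 2 ℝ K ℝ).smulRight (ψ p.fst) with hL
  have hT0 : (p.snd • (fderiv ℝ ψ p.fst : K →ₗ[ℝ] EuclideanSpace ℝ (Fin N))).normDet =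
      p.snd ^ finrank ℝ K * areaJacobian ψ p.fst := by
    rw [LinearMap.normDet_smul, Real.norm_of_nonneg hr.le, areaJacobian]
  have hT1 : (p.snd • (fderiv ℝ ψ p.fst : K →ₗ[ℝ] EuclideanSpace ℝ (Fin N))).normDet ≠ 0 := by
    rw [hT0]
    exact mul_ne_zero (pow_ne_zero _ hr.ne') (hJ _ hp)
  have hA : ∀ w : K, (L : WithLp 2 (K × ℝ) →ₗ[ℝ] EuclideanSpace ℝ (Fin N)) (WithLp.toLp 2 (w, 0)) =
      (p.snd • (fderiv ℝ ψ p.fst : K →ₗ[ℝ] EuclideanSpace ℝ (Fin N))) w := by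
    intro w
    simp [hL]
  have key := normDet_sq_eq_add (L : WithLp 2 (K × ℝ) →ₗ[ℝ] EuclideanSpace ℝ (Fin N))
    (((pairCLM N).comp (L.prod (d • WithLp.sndL 2 ℝ K ℝ)) :
      WithLp 2 (K × ℝ) →L[ℝ] EuclideanSpace ℝ (Fin (N + 1))) :
      WithLp 2 (K × ℝ) →ₗ[ℝ] EuclideanSpace ℝ (Fin (N + 1)))
    (p.snd • (fderiv ℝ ψ p.fst : K →ₗ[ℝ] EuclideanSpace ℝ (Fin N))) d hA hT1 (fun a b => by
      simp only [ContinuousLinearMap.coe_coe, ContinuousLinearMap.comp_apply, pairCLM_apply,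
        inner_pairPoint, ContinuousLinearMap.prod_apply, smul_apply,
        WithLp.sndL_apply, smul_eq_mul]
      ring)
  rw [hT0] at key
  rwa [areaJacobian, areaJacobian, hG.fderiv, hC.fderiv]

lemma isOpen_patchDomain (hO : IsOpen O) :
    IsOpen {p : WithLp 2 (K × ℝ) | p.fst ∈ O ∧ p.snd ∈ Ioi 0} :=
  (hO.preimage (WithLp.fstL 2 ℝ (K) ℝ).continuous).inter
    (isOpen_Ioi.preimage (WithLp.sndL 2 ℝ (K) ℝ).continuous)

variable {k : ℕ}

lemma finrank_patchDomain : finrank ℝ (WithLp 2 (EuclideanSpace ℝ (Fin k) × ℝ)) = k + 1 := by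
  rw [(WithLp.linearEquiv 2 ℝ (EuclideanSpace ℝ (Fin k) × ℝ)).finrank_eq, Module.finrank_prod]
  simp

/-- The part of a Gaussian area that lies over a patch `A` and over `r ∈ R` is at most the Gaussian
area of the cone over `A` plus an integral over the dilated patches `r A`. -/
lemma lintegral_coneLift_patch_le {A : Set (EuclideanSpace ℝ (Fin N))} (hA : IsPatch k A)
    {R : Set ℝ} (hR : MeasurableSet R) (hR0 : R ⊆ Ioi 0) (hh : ContDiffOn ℝ 1 h (Ioi 0))
    (hd : ∀ r ∈ Ioi (0 : ℝ), HasDerivAt h (h' r) r) (hh' : ContinuousOn h' (Ioi 0))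
    (hne : ∀ r ∈ R, h' r ≠ 0) :
    Measurable (preimageCount (coneLift h) (A ×ˢ R)) ∧
    ∃ c : EuclideanSpace ℝ (Fin N) → ℝ≥0∞,
      (∀ y, c y ≤ preimageCount coneMap (A ×ˢ R) y) ∧
      ∫⁻ y, preimageCount (coneLift h) (A ×ˢ R) y *
          ENNReal.ofReal (gaussianWeight (k + 1) y) ∂μHE[k + 1] ≤
        (∫⁻ y, c y * ENNReal.ofReal (gaussianWeight (k + 1) y) ∂μHE[k + 1]) +
          ∫⁻ r in R, ENNReal.ofReal (|h' r| * gaussianWeight 1 (h r)) *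
            (ENNReal.ofReal r ^ k *
              ∫⁻ x in A, ENNReal.ofReal (gaussianWeight k (r • x)) ∂μHE[k]) := by
  obtain ⟨ψ, O, U, hO, hψ, hJ, hUO, hU, hinj, rfl⟩ := hA
  set Ω : Set (WithLp 2 (EuclideanSpace ℝ (Fin k) × ℝ)) := {p | p.fst ∈ O ∧ p.snd ∈ Ioi 0} with hΩ
  set B : Set (WithLp 2 (EuclideanSpace ℝ (Fin k) × ℝ)) := WithLp.ofLp ⁻¹' (U ×ˢ R) with hB
  have hΩo : IsOpen Ω := isOpen_patchDomain hO
  have hBΩ : B ⊆ Ω := fun p hp => ⟨hUO hp.1, hR0 hp.2⟩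
  have hBm : MeasurableSet B := (WithLp.measurable_ofLp 2 _) (hU.prod hR)
  have hCd := contDiffOn_patchCone hψ
  have hGd := contDiffOn_patchLift hψ hh
  -- the parameters of the patch are one-to-one, so they do not affect multiplicities
  set φ : WithLp 2 (EuclideanSpace ℝ (Fin k) × ℝ) → EuclideanSpace ℝ (Fin N) × ℝ :=
    fun p => (ψ p.fst, p.snd) with hφ
  have hφinj : InjOn φ B := by
    intro p hp q hq hpq
    simp only [hφ, Prod.mk.injEq] at hpq
    exact WithLp.ofLp_injective 2 (Prod.ext (hinj hp.1 hq.1 hpq.1) hpq.2)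
  have hφB : φ '' B = (ψ '' U) ×ˢ R := by
    ext ⟨x, r⟩
    constructor
    · rintro ⟨p, hp, hpx⟩
      simp only [hφ, Prod.mk.injEq] at hpx
      exact ⟨⟨p.fst, hp.1, hpx.1⟩, hpx.2 ▸ hp.2⟩
    · rintro ⟨⟨u, hu, hux⟩, hr⟩
      exact ⟨WithLp.toLp 2 (u, r), ⟨hu, hr⟩, Prod.ext hux rfl⟩
  have hcountG : ∀ y, preimageCount (coneLift h) ((ψ '' U) ×ˢ R) y =
      preimageCount (patchLift ψ h) B y := fun y => by
    rw [← hφB, ← preimageCount_comp_of_injOn hφinj]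
    rfl
  have hcountC : ∀ y, preimageCount coneMap ((ψ '' U) ×ˢ R) y =
      preimageCount (patchCone ψ) B y := fun y => by
    rw [← hφB, ← preimageCount_comp_of_injOn hφinj]
    rfl
  have hsq : ∀ p ∈ B, areaJacobian (patchLift ψ h) p ^ 2 = areaJacobian (patchCone ψ) p ^ 2 +
      (h' p.snd * (p.snd ^ k * areaJacobian ψ p.fst)) ^ 2 := fun p hp =>
    by simpa using areaJacobian_patchLift_sq hO hψ hJ (hBΩ hp).1 (hBΩ hp).2 (hd _ (hBΩ hp).2)
  have hGne : ∀ p ∈ B, areaJacobian (patchLift ψ h) p ≠ 0 := by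
    intro p hp h0
    have h1 := hsq p hp
    have h2 : (h' p.snd * (p.snd ^ k * areaJacobian ψ p.fst)) ≠ 0 :=
      mul_ne_zero (hne _ hp.2)
        (mul_ne_zero (pow_ne_zero _ (ne_of_gt (hR0 hp.2))) (hJ _ (hUO hp.1)))
    rw [h0] at h1
    have : 0 < (h' p.snd * (p.snd ^ k * areaJacobian ψ p.fst)) ^ 2 := by positivity
    nlinarith [sq_nonneg (areaJacobian (patchCone ψ) p)]
  have hle : ∀ p ∈ B, areaJacobian (patchLift ψ h) p ≤ areaJacobian (patchCone ψ) p +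
      |h' p.snd| * (p.snd ^ k * areaJacobian ψ p.fst) := by
    intro p hp
    have hc := areaJacobian_nonneg (patchCone ψ) p
    have hx : 0 ≤ |h' p.snd| * (p.snd ^ k * areaJacobian ψ p.fst) :=
      mul_nonneg (abs_nonneg _) (mul_nonneg (pow_nonneg (hR0 hp.2).le _) (areaJacobian_nonneg _ _))
    refine abs_le_of_sq_le_sq' ?_ (by positivity) |>.2
    rw [hsq p hp, mul_pow, ← sq_abs (h' p.snd), ← mul_pow]
    nlinarith [mul_nonneg hc hx]
  have hmG := measurable_ofReal_gaussianWeight (E := EuclideanSpace ℝ (Fin (N + 1))) (k + 1)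
  have hmC := measurable_ofReal_gaussianWeight (E := EuclideanSpace ℝ (Fin N)) (k + 1)
  obtain ⟨hGm, hGi⟩ := lintegral_preimageCount_eq_lintegral_areaJacobian_mul hΩo hGd hBΩ hBm hGne hmG
  -- the cone contributes area only where its Jacobian does not vanish
  set D : Set (WithLp 2 (EuclideanSpace ℝ (Fin k) × ℝ)) :=
    Ω ∩ areaJacobian (patchCone ψ) ⁻¹' {0}ᶜ with hD
  have hDm : MeasurableSet D :=
    ((continuousOn_areaJacobian hΩo hCd).isOpen_inter_preimage hΩo isOpen_compl_singleton).measurableSet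
  obtain ⟨-, hCi⟩ := lintegral_preimageCount_eq_lintegral_areaJacobian_mul hΩo hCd
    (inter_subset_left.trans hBΩ) (hBm.inter hDm) (fun p hp => hp.2.2) hmC
  rw [finrank_patchDomain] at hGi hCi
  have hfun : preimageCount (coneLift h) ((ψ '' U) ×ˢ R) = preimageCount (patchLift ψ h) B :=
    funext hcountG
  refine ⟨hfun ▸ hGm, preimageCount (patchCone ψ) (B ∩ D),
    fun y => (preimageCount_mono inter_subset_left y).trans (hcountC y).ge, ?_⟩
  rw [hfun, hGi, hCi]
  have hzero : ∫⁻ p in B \ D, ENNReal.ofReal (areaJacobian (patchCone ψ) p) *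
      ENNReal.ofReal (gaussianWeight (k + 1) (patchCone ψ p)) = 0 := by
    refine (setLIntegral_congr_fun (hBm.diff hDm) fun p hp => ?_).trans lintegral_zero
    have : areaJacobian (patchCone ψ) p = 0 := by
      by_contra hne
      exact hp.2 ⟨hBΩ hp.1, hne⟩
    simp [this]
  have hCB : ∫⁻ p in B ∩ D, ENNReal.ofReal (areaJacobian (patchCone ψ) p) *
      ENNReal.ofReal (gaussianWeight (k + 1) (patchCone ψ p)) =
      ∫⁻ p in B, ENNReal.ofReal (areaJacobian (patchCone ψ) p) *
      ENNReal.ofReal (gaussianWeight (k + 1) (patchCone ψ p)) := by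
    rw [← lintegral_inter_add_sdiff _ B hDm, hzero, add_zero]
  rw [hCB]
  have hCae : AEMeasurable (fun p => ENNReal.ofReal (areaJacobian (patchCone ψ) p) *
      ENNReal.ofReal (gaussianWeight (k + 1) (patchCone ψ p))) (volume.restrict B) :=
    ((((continuousOn_areaJacobian hΩo hCd).mono hBΩ).aemeasurable hBm).ennreal_ofReal).mul
      (hmC.comp_aemeasurable ((hCd.continuousOn.mono hBΩ).aemeasurable hBm))
  -- the contribution of the height, in the product parameters `(u, r)`
  set f : EuclideanSpace ℝ (Fin k) × ℝ → ℝ≥0∞ := fun q =>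
    ENNReal.ofReal (|h' q.2| * gaussianWeight 1 (h q.2)) * (ENNReal.ofReal q.2 ^ k *
      (ENNReal.ofReal (areaJacobian ψ q.1) * ENNReal.ofReal (gaussianWeight k (q.2 • ψ q.1))))
    with hf
  have hfm : AEMeasurable f ((volume.prod volume).restrict (U ×ˢ R)) := by
    have hUR : MeasurableSet (U ×ˢ R) := hU.prod hR
    have c1 : ContinuousOn (fun q : EuclideanSpace ℝ (Fin k) × ℝ => ψ q.1) (U ×ˢ R) :=
      (hψ.continuousOn.mono hUO).comp continuousOn_fst fun q hq => hq.1
    have c2 : ContinuousOn (fun q : EuclideanSpace ℝ (Fin k) × ℝ => areaJacobian ψ q.1) (U ×ˢ R) :=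
      ((continuousOn_areaJacobian hO hψ).mono hUO).comp continuousOn_fst fun q hq => hq.1
    have c3 : ContinuousOn (fun q : EuclideanSpace ℝ (Fin k) × ℝ => h q.2) (U ×ˢ R) :=
      (hh.continuousOn.mono hR0).comp continuousOn_snd fun q hq => hq.2
    have c4 : ContinuousOn (fun q : EuclideanSpace ℝ (Fin k) × ℝ => h' q.2) (U ×ˢ R) :=
      (hh'.mono hR0).comp continuousOn_snd fun q hq => hq.2
    have m1 : AEMeasurable (fun q : EuclideanSpace ℝ (Fin k) × ℝ =>
        ENNReal.ofReal (|h' q.2| * gaussianWeight 1 (h q.2)))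
        ((volume.prod volume).restrict (U ×ˢ R)) :=
      ((c4.abs.mul ((continuous_gaussianWeight 1).comp_continuousOn c3)).aemeasurable
        hUR).ennreal_ofReal
    have m2 : AEMeasurable (fun q : EuclideanSpace ℝ (Fin k) × ℝ => ENNReal.ofReal q.2 ^ k)
        ((volume.prod volume).restrict (U ×ˢ R)) :=
      (measurable_snd.ennreal_ofReal.pow_const k).aemeasurable
    have m3 : AEMeasurable (fun q : EuclideanSpace ℝ (Fin k) × ℝ =>
        ENNReal.ofReal (areaJacobian ψ q.1)) ((volume.prod volume).restrict (U ×ˢ R)) :=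
      (c2.aemeasurable hUR).ennreal_ofReal
    have m4 : AEMeasurable (fun q : EuclideanSpace ℝ (Fin k) × ℝ =>
        ENNReal.ofReal (gaussianWeight k (q.2 • ψ q.1)))
        ((volume.prod volume).restrict (U ×ˢ R)) := (((continuous_gaussianWeight k).comp_continuousOn
        (continuousOn_snd.smul c1)).aemeasurable hUR).ennreal_ofReal
    exact m1.mul (m2.mul (m3.mul m4))
  have hint : ∫⁻ p in B, f (WithLp.ofLp p) =
      ∫⁻ r in R, ENNReal.ofReal (|h' r| * gaussianWeight 1 (h r)) * (ENNReal.ofReal r ^ k *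
        ∫⁻ x in ψ '' U, ENNReal.ofReal (gaussianWeight k (r • x)) ∂μHE[k]) := by
    rw [hB, (WithLp.volume_preserving_ofLp (EuclideanSpace ℝ (Fin k)) ℝ).setLIntegral_comp_preimage_emb
      (MeasurableEquiv.toLp 2 (EuclideanSpace ℝ (Fin k) × ℝ)).symm.measurableEmbedding,
      Measure.volume_eq_prod, setLIntegral_prod_symm f hfm]
    refine setLIntegral_congr_fun hR fun r hr => ?_
    simp only [hf]
    have hmr : Measurable fun x : EuclideanSpace ℝ (Fin N) =>
        ENNReal.ofReal (gaussianWeight k (r • x)) :=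
      (measurable_ofReal_gaussianWeight k).comp (measurable_const_smul r)
    have := lintegral_image_eq_lintegral_areaJacobian_mul hO hψ hUO hU hinj
      (fun u hu => hJ u (hUO hu)) hmr
    rw [finrank_euclideanSpace_fin] at this
    rw [this, lintegral_const_mul' _ _ ENNReal.ofReal_ne_top,
      lintegral_const_mul' _ _ (ENNReal.pow_ne_top ENNReal.ofReal_ne_top)]
  rw [← hint, ← lintegral_add_left' hCae]
  refine setLIntegral_mono' hBm fun p hp => ?_
  have hr : 0 ≤ p.snd := (hR0 hp.2).le
  have hw : gaussianWeight (k + 1) (patchLift ψ h p) =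
      gaussianWeight k (patchCone ψ p) * gaussianWeight 1 (h p.snd) := gaussianWeight_pairPoint _ _ _
  calc ENNReal.ofReal (areaJacobian (patchLift ψ h) p) *
        ENNReal.ofReal (gaussianWeight (k + 1) (patchLift ψ h p))
      ≤ (ENNReal.ofReal (areaJacobian (patchCone ψ) p) +
          ENNReal.ofReal (|h' p.snd| * (p.snd ^ k * areaJacobian ψ p.fst))) *
        ENNReal.ofReal (gaussianWeight (k + 1) (patchLift ψ h p)) := by
        gcongr
        exact (ENNReal.ofReal_le_ofReal (hle p hp)).trans ENNReal.ofReal_add_le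
    _ ≤ _ := by
        rw [add_mul]
        refine add_le_add (mul_le_mul_right (ENNReal.ofReal_le_ofReal
          (gaussianWeight_pairPoint_le _ _ _)) _) (le_of_eq ?_)
        have e : f (WithLp.ofLp p) = ENNReal.ofReal (|h' p.snd| * gaussianWeight 1 (h p.snd)) *
          (ENNReal.ofReal p.snd ^ k * (ENNReal.ofReal (areaJacobian ψ p.fst) *
            ENNReal.ofReal (gaussianWeight k (patchCone ψ p)))) := rfl
        rw [e, hw, ← ENNReal.ofReal_pow hr, ← ENNReal.ofReal_mul (areaJacobian_nonneg _ _),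
          ← ENNReal.ofReal_mul (pow_nonneg hr _),
          ← ENNReal.ofReal_mul (mul_nonneg (abs_nonneg _) (gaussianWeight_nonneg _ _)),
          ← ENNReal.ofReal_mul (mul_nonneg (abs_nonneg _)
            (mul_nonneg (pow_nonneg hr _) (areaJacobian_nonneg _ _)))]
        congr 1
        ring

end ConeLift

/-! ### Gaussian integrals -/

lemma lintegral_gaussianWeight_eq_one (V : Type*) [NormedAddCommGroup V] [InnerProductSpace ℝ V]
    [FiniteDimensional ℝ V] [MeasurableSpace V] [BorelSpace V] :
    ∫⁻ x : V, ENNReal.ofReal (gaussianWeight (finrank ℝ V) x) = 1 := by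
  have h1 : ∫ x : V, gaussianWeight (finrank ℝ V) x = 1 := by
    have := GaussianFourier.integral_rexp_neg_mul_sq_norm (V := V) (b := 1 / 4) (by norm_num)
    have e : ∀ x : V, gaussianWeight (finrank ℝ V) x =
        (4 * Real.pi) ^ (-(finrank ℝ V : ℝ) / 2) * Real.exp (-(1 / 4) * ‖x‖ ^ 2) := fun x => by
      unfold gaussianWeight
      congr 2
      ring
    simp_rw [e]
    rw [integral_const_mul, this, show Real.pi / (1 / 4) = 4 * Real.pi by ring,
      ← Real.rpow_add (by positivity)]
    ring_nf
    exact Real.rpow_zero _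
  have hi : Integrable fun x : V => gaussianWeight (finrank ℝ V) x :=
    Integrable.of_integral_ne_zero (by rw [h1]; exact one_ne_zero)
  rw [← ofReal_integral_eq_lintegral_ofReal hi (ae_of_all _ fun x => gaussianWeight_nonneg _ x), h1,
    ENNReal.ofReal_one]

lemma euclideanHausdorffMeasure_succ_singleton {X : Type*} [MetricSpace X] [MeasurableSpace X]
    [BorelSpace X] (k : ℕ) (x : X) : μHE[k + 1] ({x} : Set X) = 0 := by
  refine (Measure.euclideanHausdorffMeasure_zero_or_top (Nat.succ_pos k) {x}).resolve_right ?_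
  rw [Measure.euclideanHausdorffMeasure_zero, Measure.hausdorffMeasure_zero_singleton]
  exact ENNReal.one_ne_top

lemma norm_preimage_Iic {W : Type*} [SeminormedAddCommGroup W] (b : ℝ) :
    (norm : W → ℝ) ⁻¹' Iic b = Metric.closedBall 0 b := by
  ext x
  simp

lemma gaussianWeight_norm {W : Type*} [NormedAddCommGroup W] (m : ℕ) (y : W) :
    gaussianWeight m ‖y‖ = gaussianWeight m y := by
  unfold gaussianWeight
  rw [norm_norm]

/-- The Gaussian area of a cone, counted with multiplicity, is at most its density: the area measure
of the cone and a multiple of the Lebesgue measure of `ℝ^{k+1}` give the same mass to all balls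
centred at the origin, and the Gaussian weight is radial of total mass one. -/
lemma lintegral_preimageCount_coneMap_le {E : Type*} [NormedAddCommGroup E] [InnerProductSpace ℝ E]
    [FiniteDimensional ℝ E] [MeasurableSpace E] [BorelSpace E] (k : ℕ) {S : Set E}
    (hS : IsClosed S) :
    ∫⁻ y, preimageCount coneMap (S ×ˢ Ioi (0 : ℝ)) y *
      ENNReal.ofReal (gaussianWeight (k + 1) y) ∂μHE[k + 1] ≤ coneDensity (k + 1) S := by
  have : ProperSpace E := FiniteDimensional.proper_real E
  rcases eq_or_ne (coneDensity (k + 1) S) ⊤ with htop | hfin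
  · rw [htop]
    exact le_top
  set θ := coneDensity (k + 1) S with hθ
  set c : E → ℝ≥0∞ := preimageCount coneMap (S ×ˢ Ioi (0 : ℝ)) with hc
  have hcm : Measurable c := by
    have hSI : S ×ˢ Ioi (0 : ℝ) = (S ×ˢ univ) ∩ (univ ×ˢ Ioi (0 : ℝ)) := by
      rw [prod_inter_prod, inter_univ, univ_inter]
    rw [hc, hSI]
    refine measurable_preimageCount_closed_inter_open (hS.prod isClosed_univ)
      (isOpen_univ.prod isOpen_Ioi) (Continuous.continuousOn ?_)
    exact continuous_snd.smul continuous_fst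
  set V := EuclideanSpace ℝ (Fin (k + 1))
  have hω0 : unitBallVolume (k + 1) ≠ 0 :=
    (Metric.measure_ball_pos volume (0 : V) one_pos).ne'
  have hωt : unitBallVolume (k + 1) ≠ ⊤ := (measure_ball_lt_top (x := (0 : V))).ne
  have harea : ∀ R : ℝ, 0 < R → coneArea (k + 1) S R = θ * volume (Metric.closedBall (0 : V) R) := by
    intro R hR
    have h1 : coneArea (k + 1) S 1 = θ * unitBallVolume (k + 1) := by
      rw [hθ, coneDensity, ENNReal.div_mul_cancel hω0 hωt]
    rw [coneArea_eq _ _ hR, h1, Measure.addHaar_closedBall _ _ hR.le, finrank_euclideanSpace_fin,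
      ENNReal.ofReal_pow hR.le, unitBallVolume]
    ring
  set ν : Measure E := (μHE[k + 1] : Measure E).withDensity c with hν
  have hνIic : ∀ b : ℝ, ν.map norm (Iic b) = (θ • (volume : Measure V)).map norm (Iic b) := by
    intro b
    rw [Measure.map_apply measurable_norm measurableSet_Iic,
      Measure.map_apply measurable_norm measurableSet_Iic]
    rw [norm_preimage_Iic, norm_preimage_Iic, Measure.smul_apply, smul_eq_mul]
    rcases lt_trichotomy b 0 with hb | rfl | hb
    · simp [Metric.closedBall_eq_empty.2 hb]
    · rw [Metric.closedBall_zero, Metric.closedBall_zero,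
        measure_singleton (μ := (volume : Measure V)), mul_zero]
      exact withDensity_absolutelyContinuous _ _ (euclideanHausdorffMeasure_succ_singleton k _)
    · rw [hν, withDensity_apply _ Metric.isClosed_closedBall.measurableSet]
      exact harea b hb
  have hfinIic : ∀ b : ℝ, (θ • (volume : Measure V)).map norm (Iic b) ≠ ⊤ := by
    intro b
    rw [Measure.map_apply measurable_norm measurableSet_Iic]
    refine (ENNReal.mul_lt_top hfin.lt_top ?_).ne
    refine (measure_mono fun x hx => ?_).trans_lt (measure_closedBall_lt_top (x := (0 : V)) (r := b))
    simpa using hx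
  have hmap : ν.map norm = (θ • (volume : Measure V)).map norm := by
    refine Measure.ext_of_Ioc' _ _ (fun a b hab => ?_) fun a b hab => ?_
    · refine ((measure_mono Ioc_subset_Iic_self).trans_lt ?_).ne
      rw [hνIic]
      exact (hfinIic b).lt_top
    · rw [← Iic_sdiff_Iic, measure_sdiff (Iic_subset_Iic.2 hab.le)
        measurableSet_Iic.nullMeasurableSet (by rw [hνIic]; exact hfinIic a),
        measure_sdiff (Iic_subset_Iic.2 hab.le) measurableSet_Iic.nullMeasurableSet (hfinIic a),
        hνIic, hνIic]
  have hmR := measurable_ofReal_gaussianWeight (E := ℝ) (k + 1)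
  calc ∫⁻ y, c y * ENNReal.ofReal (gaussianWeight (k + 1) y) ∂μHE[k + 1]
      = ∫⁻ y, ENNReal.ofReal (gaussianWeight (k + 1) y) ∂ν :=
        (lintegral_withDensity_eq_lintegral_mul _ hcm (measurable_ofReal_gaussianWeight _)).symm
    _ = ∫⁻ y, ENNReal.ofReal (gaussianWeight (k + 1) ‖y‖) ∂ν := by simp_rw [gaussianWeight_norm]
    _ = ∫⁻ t, ENNReal.ofReal (gaussianWeight (k + 1) t) ∂(ν.map norm) :=
        (lintegral_map hmR measurable_norm).symm
    _ = ∫⁻ y : V, ENNReal.ofReal (gaussianWeight (k + 1) ‖y‖) ∂(θ • (volume : Measure V)) := by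
        rw [hmap, lintegral_map hmR measurable_norm]
    _ = θ * ∫⁻ y : V, ENNReal.ofReal (gaussianWeight (finrank ℝ V) y) := by
        rw [lintegral_smul_measure, finrank_euclideanSpace_fin, smul_eq_mul]
        simp_rw [gaussianWeight_norm]
    _ ≤ θ := by rw [lintegral_gaussianWeight_eq_one, mul_one]

/-- The Gaussian area of a dilate `r S` of `S` is at most the entropy of `S`. -/
lemma lintegral_gaussianWeight_smul_le_entropy {E : Type*} [NormedAddCommGroup E]
    [InnerProductSpace ℝ E] [MeasurableSpace E] [BorelSpace E] (k : ℕ) (S : Set E) {r : ℝ}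
    (hr : 0 < r) :
    ENNReal.ofReal r ^ k * ∫⁻ x in S, ENNReal.ofReal (gaussianWeight k (r • x)) ∂μHE[k] ≤
      entropy k S := by
  have hemb : MeasurableEmbedding (fun x : E => r • x) :=
    (Homeomorph.smulOfNeZero r hr.ne').measurableEmbedding
  have hmap : (μHE[k] : Measure E) =
      ENNReal.ofReal r ^ k • Measure.map (fun x : E => r • x) μHE[k] := by
    ext s hs
    have h := Measure.euclideanHausdorffMeasure_smul₀ k hr.ne' ((fun x : E => r • x) ⁻¹' s)
    have hs' : r • ((fun x : E => r • x) ⁻¹' s) = s :=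
      image_preimage_eq s (Homeomorph.smulOfNeZero (α := E) r hr.ne').surjective
    rw [hs'] at h
    rw [Measure.smul_apply, hemb.map_apply, h, ENNReal.smul_def, ENNReal.coe_pow, smul_eq_mul,
      smul_eq_mul, ENNReal.ofReal]
    congr 3
    ext
    simp [abs_of_pos hr, hr.le]
  refine le_trans (le_of_eq ?_) (le_iSup₂_of_le r hr (le_iSup _ 0))
  unfold gaussianArea
  simp only [add_zero]
  conv_rhs => rw [hmap]
  rw [Measure.restrict_smul, lintegral_smul_measure, hemb.restrict_map, hemb.lintegral_map,
    preimage_image_eq _ hemb.injective, smul_eq_mul]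

/-! ### The Gaussian length of the heights -/

/-- The height `v (a r - 1 / r)` of the rescaled family in terms of `r = |t|^{-1/2}`. -/
noncomputable def height (a v r : ℝ) : ℝ := v * (a * r - r⁻¹)

lemma hasDerivAt_height (a v : ℝ) {r : ℝ} (hr : 0 < r) :
    HasDerivAt (height a v) (v * (a + (r ^ 2)⁻¹)) r := by
  have h := (((hasDerivAt_id r).const_mul a).sub (hasDerivAt_inv hr.ne')).const_mul v
  have e : v * (a * 1 - -(r ^ 2)⁻¹) = v * (a + (r ^ 2)⁻¹) := by ring
  rw [e] at h
  exact h

lemma height_sub_height (a v : ℝ) {r s : ℝ} (hr : 0 < r) (hs : 0 < s) :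
    height a v r - height a v s = v * ((r - s) * (a + (r * s)⁻¹)) := by
  unfold height
  field_simp
  ring

/-- The height is one-to-one where it increases and where it decreases; if it does both, then it has
a constant sign, so reflecting the second branch makes the two branches disjoint, and the total
Gaussian length is at most that of the line. -/
lemma lintegral_height_le_one (a v : ℝ) {R : Set ℝ}
    (hR : R = {r | 0 < r ∧ v * (a + (r ^ 2)⁻¹) ≠ 0}) :
    ∫⁻ r in R, ENNReal.ofReal (|v * (a + (r ^ 2)⁻¹)| * gaussianWeight 1 (height a v r)) ≤ 1 := by
  rcases eq_or_ne v 0 with rfl | hv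
  · simp [hR]
  set R₁ : Set ℝ := {r | 0 < r ∧ 0 < a + (r ^ 2)⁻¹} with hR₁
  set R₂ : Set ℝ := {r | 0 < r ∧ a + (r ^ 2)⁻¹ < 0} with hR₂
  have hmd : Measurable fun r : ℝ => a + (r ^ 2)⁻¹ := by fun_prop
  have hR₁m : MeasurableSet R₁ := measurableSet_Ioi.inter (hmd measurableSet_Ioi)
  have hR₂m : MeasurableSet R₂ := measurableSet_Ioi.inter (hmd measurableSet_Iio)
  have hR12 : R = R₁ ∪ R₂ := by
    rw [hR]
    ext r
    simp only [mem_ofPred_eq, mem_union, hR₁, hR₂, ne_eq, mul_eq_zero, hv, false_or]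
    rw [← and_or_left, or_comm, lt_or_lt_iff_ne]
  have hdisj : Disjoint R₁ R₂ :=
    disjoint_left.2 fun r h1 h2 => lt_asymm h1.2 h2.2
  have hd1 : ∀ r ∈ R₁, HasDerivWithinAt (height a v) (v * (a + (r ^ 2)⁻¹)) R₁ r :=
    fun r hr => (hasDerivAt_height a v hr.1).hasDerivWithinAt
  have hd2 : ∀ r ∈ R₂, HasDerivWithinAt (fun r => -height a v r) (-(v * (a + (r ^ 2)⁻¹))) R₂ r :=
    fun r hr => (hasDerivAt_height a v hr.1).neg.hasDerivWithinAt
  have hi1 : InjOn (height a v) R₁ := by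
    intro r hr s hs hrs
    have h := height_sub_height a v hr.1 hs.1
    rw [hrs, sub_self, eq_comm, mul_eq_zero, mul_eq_zero] at h
    rcases h with h | h | h
    · exact absurd h hv
    · exact sub_eq_zero.1 h
    · -- `1 / (r s)` lies between `1 / r²` and `1 / s²`, so `a + 1 / (r s)` has their common sign
      exfalso
      have hr' := hr.2
      have hs' := hs.2
      rw [mul_inv] at h
      rw [← inv_pow] at hr' hs'
      have hr0 := inv_pos.2 hr.1
      have hs0 := inv_pos.2 hs.1
      rcases le_total r⁻¹ s⁻¹ with hl | hl <;> nlinarith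
  have hi2 : InjOn (fun r => -height a v r) R₂ := by
    intro r hr s hs hrs
    have h := height_sub_height a v hr.1 hs.1
    rw [neg_injective hrs, sub_self, eq_comm, mul_eq_zero, mul_eq_zero] at h
    rcases h with h | h | h
    · exact absurd h hv
    · exact sub_eq_zero.1 h
    · exfalso
      have hr' := hr.2
      have hs' := hs.2
      rw [mul_inv] at h
      rw [← inv_pow] at hr' hs'
      have hr0 := inv_pos.2 hr.1
      have hs0 := inv_pos.2 hs.1
      rcases le_total r⁻¹ s⁻¹ with hl | hl <;> nlinarith
  have him : MeasurableSet ((fun r => -height a v r) '' R₂) :=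
    hR₂m.image_of_continuousOn_injOn (fun r hr => (hd2 r hr).continuousWithinAt) hi2
  have himd : Disjoint (height a v '' R₁) ((fun r => -height a v r) '' R₂) := by
    rw [disjoint_left]
    rintro _ ⟨r, hr, rfl⟩ ⟨s, hs, hrs⟩
    -- a decreasing branch forces `a < 0`, and then `a r - 1 / r < 0` for all `r > 0`
    have hs' := hs.2
    have hs0 : 0 < (s ^ 2)⁻¹ := inv_pos.2 (pow_pos hs.1 2)
    have ha : a < 0 := by linarith
    unfold height at hrs
    have h0 : v * ((a * r - r⁻¹) + (a * s - s⁻¹)) = 0 := by linarith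
    have h1 := (mul_eq_zero.1 h0).resolve_left hv
    have h2 := mul_neg_of_neg_of_pos ha hr.1
    have h3 := mul_neg_of_neg_of_pos ha hs.1
    have h4 := inv_pos.2 hr.1
    have h5 := inv_pos.2 hs.1
    linarith
  have e1 : ∫⁻ r in R₁, ENNReal.ofReal (|v * (a + (r ^ 2)⁻¹)| * gaussianWeight 1 (height a v r)) =
      ∫⁻ z in height a v '' R₁, ENNReal.ofReal (gaussianWeight 1 z) := by
    rw [lintegral_image_eq_lintegral_abs_deriv_mul hR₁m hd1 hi1]
    exact setLIntegral_congr_fun hR₁m fun r _ => ENNReal.ofReal_mul (abs_nonneg _)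
  have e2 : ∫⁻ r in R₂, ENNReal.ofReal (|v * (a + (r ^ 2)⁻¹)| * gaussianWeight 1 (height a v r)) =
      ∫⁻ z in (fun r => -height a v r) '' R₂, ENNReal.ofReal (gaussianWeight 1 z) := by
    rw [lintegral_image_eq_lintegral_abs_deriv_mul hR₂m hd2 hi2]
    refine setLIntegral_congr_fun hR₂m fun r _ => ?_
    rw [ENNReal.ofReal_mul (abs_nonneg _), abs_neg]
    congr 2
    unfold gaussianWeight
    rw [norm_neg]
  rw [hR12, lintegral_union hR₂m hdisj, e1, e2, ← lintegral_union him himd]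
  refine (setLIntegral_le_lintegral _ _).trans ?_
  have := lintegral_gaussianWeight_eq_one ℝ
  rw [Module.finrank_self] at this
  exact this.le

/-! ### The rescaled translating family -/

section Rescaled

variable {N : ℕ}

lemma rescaledMap_eq_coneLift (a v : ℝ) {p : EuclideanSpace ℝ (Fin N) × ℝ} (hp : p.2 < 0) :
    rescaledMap a v p = coneLift (height a v) (p.1, (√|p.2|)⁻¹) := by
  have hs : 0 < √|p.2| := Real.sqrt_pos.2 (abs_pos.2 hp.ne)
  have hsq : p.2 = -(√|p.2|) ^ 2 := by
    rw [Real.sq_sqrt (abs_nonneg _), abs_of_neg hp, neg_neg]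
  have e : translatingMap a v p = pairCLM N (p.1, (a + p.2) * v) := by
    have : EuclideanSpace.single (Fin.last N) (1 : ℝ) = pairCLM N (0, 1) := by
      ext i
      refine Fin.lastCases ?_ (fun i => ?_) i <;> simp [pairPoint]
    rw [translatingMap, this, ← map_smul, show pairPoint p.1 0 = pairCLM N (p.1, 0) from rfl,
      ← map_add]
    simp
  rw [rescaledMap, e, ← map_smul, coneLift, coneMap, pairCLM_apply]
  congr 1
  simp only [Prod.smul_mk, smul_eq_mul, height, inv_inv]
  set s := √|p.2|
  rw [hsq]
  field_simp
  ring

lemma injOn_inv_sqrt_abs (S : Set (EuclideanSpace ℝ (Fin N))) :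
    InjOn (fun p : EuclideanSpace ℝ (Fin N) × ℝ => (p.1, (√|p.2|)⁻¹)) (S ×ˢ Iio 0) := by
  rintro ⟨x, s⟩ hs ⟨y, t⟩ ht h
  simp only [Prod.mk.injEq, inv_inj] at h
  have := (Real.sqrt_inj (abs_nonneg _) (abs_nonneg _)).1 h.2
  rw [abs_of_neg hs.2, abs_of_neg ht.2, neg_inj] at this
  rw [h.1, this]

lemma image_inv_sqrt_abs (S : Set (EuclideanSpace ℝ (Fin N))) :
    (fun p : EuclideanSpace ℝ (Fin N) × ℝ => (p.1, (√|p.2|)⁻¹)) '' (S ×ˢ Iio 0) = S ×ˢ Ioi 0 := by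
  ext ⟨x, r⟩
  constructor
  · rintro ⟨⟨y, t⟩, ⟨hy, ht⟩, h⟩
    simp only [Prod.mk.injEq] at h
    exact ⟨h.1 ▸ hy, h.2 ▸ inv_pos.2 (Real.sqrt_pos.2 (abs_pos.2 (ne_of_lt ht)))⟩
  · rintro ⟨hx, hr⟩
    have hr : 0 < r := hr
    refine ⟨(x, -(r⁻¹) ^ 2), ⟨hx, ?_⟩, ?_⟩
    · have : 0 < r⁻¹ ^ 2 := by positivity
      exact neg_neg_of_pos this
    · simp only [Prod.mk.injEq, true_and]
      rw [abs_neg, abs_of_nonneg (by positivity), Real.sqrt_sq (by positivity), inv_inv]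

lemma preimageCount_rescaledMap (a v : ℝ) (S : Set (EuclideanSpace ℝ (Fin N)))
    (y : EuclideanSpace ℝ (Fin (N + 1))) :
    preimageCount (rescaledMap a v) (S ×ˢ Iio (0 : ℝ)) y =
      preimageCount (coneLift (height a v)) (S ×ˢ Ioi (0 : ℝ)) y := by
  rw [← image_inv_sqrt_abs, ← preimageCount_comp_of_injOn (injOn_inv_sqrt_abs S)]
  exact preimageCount_congr (fun p hp => rescaledMap_eq_coneLift a v hp.2) y

lemma measurableSet_image_rescaledMap (a v : ℝ) {S : Set (EuclideanSpace ℝ (Fin N))}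
    (hS : IsClosed S) : MeasurableSet (rescaledMap a v '' (S ×ˢ Iio (0 : ℝ))) := by
  have hSI : S ×ˢ Iio (0 : ℝ) = (S ×ˢ univ) ∩ (univ ×ˢ Iio (0 : ℝ)) := by
    rw [prod_inter_prod, inter_univ, univ_inter]
  rw [hSI]
  refine measurableSet_image_closed_inter_open (hS.prod isClosed_univ)
    (isOpen_univ.prod isOpen_Iio) ?_
  have hc : Continuous fun p : EuclideanSpace ℝ (Fin N) × ℝ => translatingMap a v p := by
    have : Continuous fun p : EuclideanSpace ℝ (Fin N) × ℝ => pairCLM N (p.1, 0) := by fun_prop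
    exact this.add (by fun_prop)
  have hs : Continuous fun p : EuclideanSpace ℝ (Fin N) × ℝ => √|p.2| := by fun_prop
  refine ContinuousOn.smul (hs.continuousOn.inv₀ fun p hp => ?_) hc.continuousOn
  exact (Real.sqrt_pos.2 (abs_pos.2 (ne_of_lt hp.2.2))).ne'

end Rescaled

/-- Superadditivity of the lower Lebesgue integral, which needs no measurability. -/
lemma tsum_lintegral_le_lintegral_tsum {α : Type*} [MeasurableSpace α] {μ : Measure α}
    (f : ℕ → α → ℝ≥0∞) : ∑' n, ∫⁻ x, f n x ∂μ ≤ ∫⁻ x, ∑' n, f n x ∂μ := by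
  classical
  have h : ∀ s : Finset ℕ, ∑ n ∈ s, ∫⁻ x, f n x ∂μ ≤ ∫⁻ x, ∑ n ∈ s, f n x ∂μ := by
    intro s
    induction s using Finset.induction_on with
    | empty => simp
    | insert n s hn ih =>
      simp_rw [Finset.sum_insert hn]
      exact (add_le_add_right ih _).trans (le_lintegral_add _ _)
  rw [ENNReal.tsum_eq_iSup_sum]
  exact iSup_le fun s => (h s).trans (lintegral_mono fun x => ENNReal.sum_le_tsum s)

section Main

variable {k N : ℕ} {S : Set (EuclideanSpace ℝ (Fin N))}

/-- For vanishing velocity the rescaled family is an isometric copy of the cone. -/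
lemma lintegral_coneLift_zero_le (hS : IsClosed S) :
    ∫⁻ y, preimageCount (coneLift fun _ => 0) (S ×ˢ Ioi (0 : ℝ)) y *
      ENNReal.ofReal (gaussianWeight (k + 1) y) ∂μHE[k + 1] ≤ coneDensity (k + 1) S := by
  set ι : EuclideanSpace ℝ (Fin N) → EuclideanSpace ℝ (Fin (N + 1)) := fun x => pairPoint x 0
  have hnorm : ∀ x, ‖ι x‖ = ‖x‖ := fun x => by
    rw [← sq_eq_sq₀ (norm_nonneg _) (norm_nonneg _), norm_pairPoint_sq]
    ring
  have hι : Isometry ι := by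
    refine Isometry.of_dist_eq fun x y => ?_
    rw [dist_eq_norm, dist_eq_norm, ← hnorm (x - y)]
    congr 1
    have := map_sub (pairCLM N) (x, 0) (y, 0)
    simpa using this.symm
  have hemb : MeasurableEmbedding ι := hι.isClosedEmbedding.measurableEmbedding
  set c := preimageCount (coneLift fun _ => 0) (S ×ˢ Ioi (0 : ℝ)) with hc
  have hcι : ∀ x, c (ι x) = preimageCount coneMap (S ×ˢ Ioi (0 : ℝ)) x := fun x => by
    rw [hc]
    unfold preimageCount
    congr 2
    ext p
    exact and_congr_right fun _ => hι.injective.eq_iff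
  have hc0 : ∀ y ∉ range ι, c y = 0 := fun y hy => by
    refine preimageCount_eq_zero ?_
    rintro ⟨p, -, hp⟩
    exact hy ⟨coneMap p, hp⟩
  calc ∫⁻ y, c y * ENNReal.ofReal (gaussianWeight (k + 1) y) ∂μHE[k + 1]
      = ∫⁻ y in range ι, c y * ENNReal.ofReal (gaussianWeight (k + 1) y) ∂μHE[k + 1] := by
        rw [← lintegral_indicator hemb.measurableSet_range]
        refine lintegral_congr fun y => ?_
        by_cases hy : y ∈ range ι
        · rw [indicator_of_mem hy]
        · rw [indicator_of_notMem hy, hc0 y hy, zero_mul]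
    _ = ∫⁻ x, c (ι x) * ENNReal.ofReal (gaussianWeight (k + 1) (ι x)) ∂μHE[k + 1] := by
        rw [← hι.map_euclideanHausdorffMeasure, hemb.lintegral_map]
    _ = ∫⁻ x, preimageCount coneMap (S ×ˢ Ioi (0 : ℝ)) x *
          ENNReal.ofReal (gaussianWeight (k + 1) x) ∂μHE[k + 1] := by
        refine lintegral_congr fun x => ?_
        rw [hcι, ← gaussianWeight_norm _ (ι x), hnorm, gaussianWeight_norm]
    _ ≤ _ := lintegral_preimageCount_coneMap_le k hS

/-- A single slice `r = r₀` of the lift of the cone is a similar copy of `S`, hence has no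
`(k + 1)`-dimensional area. -/
lemma euclideanHausdorffMeasure_coneLift_slice (h : ℝ → ℝ) (hS : μHE[k + 1] S = 0) {Z : Set ℝ}
    (hZ : Z.Subsingleton) (hZ0 : Z ⊆ Ioi 0) : μHE[k + 1] (coneLift h '' (S ×ˢ Z)) = 0 := by
  rcases hZ.eq_empty_or_singleton with rfl | ⟨r, rfl⟩
  · simp
  have hr : 0 < r := hZ0 rfl
  have e : coneLift h '' (S ×ˢ {r}) = (fun x => coneLift h (x, r)) '' S := by
    rw [prod_singleton, image_image]
  have := euclideanHausdorffMeasure_image_le_of_dist_le (p := fun x => coneLift h (x, r))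
    (q := fun x => x) (s := S) (C := r.toNNReal) (k + 1) fun x _ y _ => by
      refine abs_le_of_sq_le_sq' ?_ (by positivity) |>.2
      have e2 : coneLift h (x, r) - coneLift h (y, r) = pairPoint (r • (x - y)) 0 := by
        have := map_sub (pairCLM N) (r • x, h r) (r • y, h r)
        simpa [smul_sub, coneLift, coneMap] using this.symm
      rw [dist_eq_norm, dist_eq_norm, e2, norm_pairPoint_sq, norm_smul, Real.norm_of_nonneg hr.le]
      exact le_of_eq (by rw [Real.coe_toNNReal _ hr.le]; ring)
  rw [e]
  simpa [hS] using this

/-- The bound on the Gaussian area of the rescaled family, obtained by summing the bounds over the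
patches of `S`. -/
lemma lintegral_coneLift_height_le (hS : IsCompact S) (hSm : IsEmbeddedSubmanifold k S)
    (a : ℝ) {v : ℝ} (hv : v ≠ 0) :
    ∫⁻ y, preimageCount (coneLift (height a v)) (S ×ˢ Ioi (0 : ℝ)) y *
      ENNReal.ofReal (gaussianWeight (k + 1) y) ∂μHE[k + 1] ≤
      entropy k S + coneDensity (k + 1) S := by
  obtain ⟨A, hA, hAd, hSA⟩ := hSm.exists_patches hS.isClosed.measurableSet
  have hS0 : μHE[k + 1] S = 0 := by
    rw [hSA]
    exact measure_iUnion_null fun n => (hA n).hausdorffMeasure_succ_eq_zero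
  set h' : ℝ → ℝ := fun r => v * (a + (r ^ 2)⁻¹) with hh'
  set R : Set ℝ := {r | 0 < r ∧ v * (a + (r ^ 2)⁻¹) ≠ 0} with hR
  set Z : Set ℝ := {r | 0 < r ∧ a + (r ^ 2)⁻¹ = 0} with hZ
  have hmd : Measurable h' := by fun_prop
  have hRm : MeasurableSet R := measurableSet_Ioi.inter (hmd (measurableSet_singleton 0).compl)
  have hRZ : Ioi (0 : ℝ) = R ∪ Z := by
    ext r
    simp only [mem_Ioi, mem_union, hR, hZ, mem_ofPred_eq, ne_eq, mul_eq_zero, hv, false_or]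
    tauto
  have hZs : Z.Subsingleton := by
    intro r hr s hs
    have h1 : (r ^ 2)⁻¹ = (s ^ 2)⁻¹ := by linarith [hr.2, hs.2]
    exact (sq_eq_sq₀ hr.1.le hs.1.le).1 (inv_inj.1 h1)
  have hd : ∀ r ∈ Ioi (0 : ℝ), HasDerivAt (height a v) (h' r) r := fun r hr =>
    hasDerivAt_height a v hr
  have hh'c : ContinuousOn h' (Ioi 0) := by
    refine continuousOn_const.mul (continuousOn_const.add (ContinuousOn.inv₀ (by fun_prop) ?_))
    exact fun r hr => (pow_pos hr 2).ne'
  have hhc : ContDiffOn ℝ 1 (height a v) (Ioi 0) := by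
    refine contDiffOn_const.mul ((contDiffOn_const.mul contDiffOn_id).sub (contDiffOn_id.inv ?_))
    exact fun r hr => ne_of_gt hr
  have hmG := measurable_ofReal_gaussianWeight (E := EuclideanSpace ℝ (Fin (N + 1))) (k + 1)
  choose hGm c hcle hle using fun n =>
    lintegral_coneLift_patch_le (hA n) hRm (fun r hr => hr.1) hhc hd hh'c (fun r hr => hr.2)
  have hdisj : Pairwise (Function.onFun Disjoint fun n => A n ×ˢ R) := fun i j hij =>
    disjoint_left.2 fun p hp hq => disjoint_left.1 (hAd hij) hp.1 hq.1
  have hSR : S ×ˢ R = ⋃ n, A n ×ˢ R := by rw [hSA, iUnion_prod_const]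
  -- the slice over the critical point of the height contributes nothing
  have hcrit : ∫⁻ y, preimageCount (coneLift (height a v)) (S ×ˢ Ioi (0 : ℝ)) y *
      ENNReal.ofReal (gaussianWeight (k + 1) y) ∂μHE[k + 1] ≤
      ∫⁻ y, preimageCount (coneLift (height a v)) (S ×ˢ R) y *
      ENNReal.ofReal (gaussianWeight (k + 1) y) ∂μHE[k + 1] := by
    have hnull := euclideanHausdorffMeasure_coneLift_slice (height a v) hS0 hZs fun r hr => hr.1
    refine lintegral_mono_ae ?_
    filter_upwards [measure_eq_zero_iff_ae_notMem.1 hnull] with y hy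
    gcongr
    rw [hRZ, prod_union]
    exact (preimageCount_union_le _ _ _).trans (by rw [preimageCount_eq_zero hy, add_zero])
  have hcone : ∑' n, ∫⁻ y, c n y * ENNReal.ofReal (gaussianWeight (k + 1) y) ∂μHE[k + 1] ≤
      coneDensity (k + 1) S := by
    refine (tsum_lintegral_le_lintegral_tsum _).trans
      (le_trans (lintegral_mono fun y => ?_) (lintegral_preimageCount_coneMap_le k hS.isClosed))
    simp only
    rw [ENNReal.tsum_mul_right]
    gcongr
    calc ∑' n, c n y ≤ ∑' n, preimageCount coneMap (A n ×ˢ R) y :=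
          ENNReal.tsum_le_tsum fun n => hcle n y
      _ = preimageCount coneMap (S ×ˢ R) y := by rw [hSR, preimageCount_iUnion hdisj]
      _ ≤ _ := preimageCount_mono (prod_mono_right fun r hr => hr.1) y
  have hw : Measurable fun r => ENNReal.ofReal (|h' r| * gaussianWeight 1 (height a v r)) := by
    have h1 : Measurable (height a v) := by
      unfold height
      fun_prop
    exact (hmd.abs.mul ((continuous_gaussianWeight 1).measurable.comp h1)).ennreal_ofReal
  have hent : ∑' n, ∫⁻ r in R, ENNReal.ofReal (|h' r| * gaussianWeight 1 (height a v r)) *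
      (ENNReal.ofReal r ^ k * ∫⁻ x in A n, ENNReal.ofReal (gaussianWeight k (r • x)) ∂μHE[k]) ≤
      entropy k S := by
    refine (tsum_lintegral_le_lintegral_tsum _).trans ?_
    calc ∫⁻ r in R, ∑' n, ENNReal.ofReal (|h' r| * gaussianWeight 1 (height a v r)) *
          (ENNReal.ofReal r ^ k * ∫⁻ x in A n, ENNReal.ofReal (gaussianWeight k (r • x)) ∂μHE[k])
        ≤ ∫⁻ r in R, ENNReal.ofReal (|h' r| * gaussianWeight 1 (height a v r)) * entropy k S := by
          refine setLIntegral_mono' hRm fun r hr => ?_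
          rw [ENNReal.tsum_mul_left, ENNReal.tsum_mul_left,
            ← lintegral_iUnion (fun n => (hA n).measurableSet) hAd, ← hSA]
          gcongr
          exact lintegral_gaussianWeight_smul_le_entropy k S hr.1
      _ = (∫⁻ r in R, ENNReal.ofReal (|h' r| * gaussianWeight 1 (height a v r))) *
            entropy k S := lintegral_mul_const _ hw
      _ ≤ 1 * entropy k S := by
          gcongr
          exact lintegral_height_le_one a v hR
      _ = entropy k S := one_mul _
  calc _ ≤ _ := hcrit
    _ = ∑' n, ∫⁻ y, preimageCount (coneLift (height a v)) (A n ×ˢ R) y *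
          ENNReal.ofReal (gaussianWeight (k + 1) y) ∂μHE[k + 1] := by
        rw [← lintegral_tsum
          (f := fun n y => preimageCount (coneLift (height a v)) (A n ×ˢ R) y *
            ENNReal.ofReal (gaussianWeight (k + 1) y))
          fun n => ((hGm n).mul hmG).aemeasurable]
        refine lintegral_congr fun y => ?_
        rw [ENNReal.tsum_mul_right, hSR, preimageCount_iUnion hdisj]
    _ ≤ _ := ENNReal.tsum_le_tsum hle
    _ = _ := ENNReal.tsum_add
    _ ≤ coneDensity (k + 1) S + entropy k S := add_le_add hcone hent
    _ = _ := add_comm _ _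

end Main

/-- With `m = k + 1` and `n = N + 1`: `S₀` is the compact embedded `(m-1)`-manifold `Σ ⊆ ℝ^{n-1}` and
`S` is the image of `Σ × (-∞, 0)` under `F̃`. The statement is the chain
`Φ_m[S] ≤ Φ_m[F̃ | Σ × (-∞, 0)] ≤ entropy(Σ) + Θ(C(Σ)) ≤ entropy(Σ) + mcd(Σ)`, whose second term is
the Gaussian area of `S` counted with multiplicity. -/
theorem mainTheorem6 (k N : ℕ) (S₀ : Set (EuclideanSpace ℝ (Fin N)))
    (hcompact : IsCompact S₀) (hmanifold : IsEmbeddedSubmanifold k S₀) (a v : ℝ) :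
    gaussianArea (k + 1) (rescaledMap a v '' (S₀ ×ˢ Iio (0 : ℝ))) ≤
        gaussianAreaMult (k + 1) (rescaledMap a v) (S₀ ×ˢ Iio (0 : ℝ)) ∧
      gaussianAreaMult (k + 1) (rescaledMap a v) (S₀ ×ˢ Iio (0 : ℝ)) ≤
        entropy k S₀ + coneDensity (k + 1) S₀ ∧
      entropy k S₀ + coneDensity (k + 1) S₀ ≤ entropy k S₀ + maximalConeDensity (k + 1) S₀ := by
  refine ⟨?_, ?_, ?_⟩
  · unfold gaussianArea gaussianAreaMult
    rw [← lintegral_indicator (measurableSet_image_rescaledMap a v hcompact.isClosed)]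
    refine lintegral_mono fun y => ?_
    have h := indicator_image_le_preimageCount (f := rescaledMap a v) (S₀ ×ˢ Iio (0 : ℝ)) y
    by_cases hy : y ∈ rescaledMap a v '' (S₀ ×ˢ Iio (0 : ℝ))
    · rw [indicator_of_mem hy] at h ⊢
      exact le_mul_of_one_le_left zero_le h
    · rw [indicator_of_notMem hy]
      exact zero_le
  · unfold gaussianAreaMult
    simp_rw [preimageCount_rescaledMap]
    rcases eq_or_ne v 0 with rfl | hv
    · have h0 : height a 0 = fun _ => 0 := funext fun r => zero_mul _
      rw [h0]
      exact (lintegral_coneLift_zero_le hcompact.isClosed).trans le_add_self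
    · exact lintegral_coneLift_height_le hcompact hmanifold a hv
  · gcongr
    refine le_iSup_of_le 0 (le_of_eq ?_)
    simp
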